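/- **Setting.** A network of $n\ge 1$ agents solves $\min_{x\in\mathbb R^d}\sum_{i=1}^n f_i(x)$ with $f_i(x)=\mathbb E_{\xi_i\sim\mathcal D_i}[\ell_i(x,\xi_i)]$. Assume: 1. every $f_i$ is differentiable, $\nabla f_i$ is $L_i$-Lipschitz ($L_i>0$) and $f_i$ is $\mu$-strongly convex, i.e. $\langle\nabla f_i(x)-\nabla f_i(y),x-y\rangle\ge\mu\|x-y\|^2$ for all $x,y$, with $\mu>0$; 2. the sampled gradients satisfy, for every fixed $x$, $\mathbb E[g_i(x,\xi_i)]=\nabla f_i(x)$ and $\mathbb E\|g_i(x,\xi_i)-\nabla f_i(x)\|^2\le\sigma_g^2$; 3. the undirected communication graph is connected, and $A=[a_{ij}]$ is doubly stochastic, with $a_{ij}$ larger than a positive constant if $j=i$ or $j$ is a neighbour of $i$, and $a_{ij}=0$ otherwise. From arbitrary deterministic initial points $x_{i,0}$, the gradient-perturbation algorithm (Algorithm 2) iterates $$x_{i,k+1}=(1-\beta_k)x_{i,k}+\beta_k\sum_{j}a_{ij}x_{j,k}-\alpha_k\Big(\frac1{\gamma_k}\sum_{l=1}^{\gamma_k}g_i(x_{i,k},\xi_{i,k}^l)+n_{i,k}\Big),$$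 where the samples $\xi_{i,k}^l\sim\mathcal D_i$ are independent over $i,k,l$; the noises $n_{i,k}\in\mathbb R^d$ are independent over $i,k$ and independent of the samples; and every coordinate of $n_{i,k}$ has the centred Laplace distribution with variance $2\sigma_k^2$. **Statement.** Let $0<a_1<1$, $a_3,\underline b>0$, $0<\epsilon<\frac18$, and $$\alpha_k=\frac{a_1}{(k+1)^{1-\epsilon}},\quad \beta_k=\frac{a_1}{(k+1)^{0.5+\epsilon}},\quad \gamma_k=\lceil a_3(k+1)^{\epsilon}\rceil,\quad \sigma_k=\underline b\,(k+1)^{\epsilon}.$$ Let $x^*$ be the minimizer of $\sum_i f_i$. For an accuracy $\tau>0$ let $K(\tau)$ be the first time $k$ at which $\mathbb E\|x_{i,k}-x^*\|^2\le\tau$ for all agents $i$; the oracle complexity (the number of gradients that an agent samples) is $\sum_{k=0}^{K(\tau)}\gamma_k$. Then there is a constant $M>0$, which may depend on the problem data and on $\epsilon$ but not on $\tau$, such that for every $\tau\in(0,1]$ (in particular for $\tau=\epsilon$) the time $K(\tau)$ exists and $$\sum_{k=0}^{K(\tau)}\gamma_k\;\le\;M\,\tau^{-\frac{1+\epsilon}{0.5-4\epsilon}}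 .$$ -/

import Mathlib

open MeasureTheory ProbabilityTheory Finset

noncomputable section

namespace PrivateDSO

/-- The decision space `ℝ^d` with its Euclidean norm. -/
abbrev Vec (d : ℕ) : Type := EuclideanSpace ℝ (Fin d)

/-- The centred Laplace distribution on `ℝ` with scale `b > 0`, i.e. with density
`exp (-|t| / b) / (2 b)`; its variance is `2 b ^ 2`. -/
def laplaceMeasure (b : ℝ) : Measure ℝ :=
  volume.withDensity fun t => ENNReal.ofReal (Real.exp (-|t| / b) / (2 * b))

/-- The data of a stochastic optimization problem distributed over `n` agents: agent `i` has a sample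
space with the local distribution `D i`, a local cost `ℓ i x ξ`, and a sampled gradient `g i x ξ`. -/
structure Problem (n d : ℕ) where
  /-- the sample space of each agent -/
  Sample : Fin n → Type*
  /-- the measurable structure of each sample space -/
  measSample : ∀ i, MeasurableSpace (Sample i)
  /-- the local distribution of each agent -/
  D : ∀ i, Measure (Sample i)
  /-- the local distributions are probability measures -/
  probD : ∀ i, IsProbabilityMeasure (D i)
  /-- the local cost functions -/
  ℓ : ∀ i, Vec d → Sample i → ℝ
  /-- the local costs have finite expectations -/
  integrable_ℓ : ∀ i x, Integrable (ℓ i x) (D i)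
  /-- the sampled gradients -/
  g : ∀ i, Vec d → Sample i → Vec d
  /-- the sampled gradients depend measurably on the point and the sample -/
  measurable_g : ∀ i, Measurable fun p : Vec d × Sample i => g i p.1 p.2

attribute [instance] Problem.measSample Problem.probD

namespace Problem

variable {n d : ℕ} (Q : Problem n d)

/-- The local objective `f i x = E_{ξ ∼ D i} [ℓ i x ξ]`. -/
def f (i : Fin n) (x : Vec d) : ℝ := ∫ ξ, Q.ℓ i x ξ ∂(Q.D i)

/-- `x` is a solution of the global problem: it minimizes `∑ i, f i`. -/
def IsOptimal (x : Vec d) : Prop := ∀ y, ∑ i, Q.f i x ≤ ∑ i, Q.f i y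

/-- Every local objective is differentiable, with Lipschitz gradient, and `μ`-strongly convex. -/
structure SmoothStronglyConvex (L : Fin n → ℝ) (μ : ℝ) : Prop where
  L_pos : ∀ i, 0 < L i
  μ_pos : 0 < μ
  differentiable : ∀ i, Differentiable ℝ (Q.f i)
  lipschitz : ∀ i x y, ‖gradient (Q.f i) x - gradient (Q.f i) y‖ ≤ L i * ‖x - y‖
  strong : ∀ i x y,
    μ * ‖x - y‖ ^ 2 ≤ inner ℝ (gradient (Q.f i) x - gradient (Q.f i) y) (x - y)

/-- The sampled gradients are unbiased, with variance at most `σg ^ 2`. -/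
structure UnbiasedBoundedVariance (σg : ℝ) : Prop where
  σg_pos : 0 < σg
  memLp : ∀ i x, MemLp (Q.g i x) 2 (Q.D i)
  unbiased : ∀ i x, ∫ ξ, Q.g i x ξ ∂(Q.D i) = gradient (Q.f i) x
  variance : ∀ i x, ∫ ξ, ‖Q.g i x ξ - gradient (Q.f i) x‖ ^ 2 ∂(Q.D i) ≤ σg ^ 2

end Problem

/-- `A` is a doubly stochastic weight matrix of the connected undirected graph `G`, where every agent
also counts as a neighbour of itself (the edges of `G` are those between distinct agents). -/
structure IsWeightMatrix {n : ℕ} (G : SimpleGraph (Fin n)) (A : Matrix (Fin n) (Fin n) ℝ) :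
    Prop where
  connected : G.Connected
  lower : ∃ η > 0, ∀ i j, (i = j ∨ G.Adj i j) → η < A i j
  zero : ∀ i j, ¬ (i = j ∨ G.Adj i j) → A i j = 0
  row_sum : ∀ i, ∑ j, A i j = 1
  col_sum : ∀ j, ∑ i, A i j = 1

/-- The randomness that the algorithm consumes: `ξ (i, k, l)` is the `l`-th sample of agent `i` at time
`k`, with law `D i`; `N (i, k)` is the privacy noise of agent `i` at time `k`, each of whose coordinates
has the Laplace distribution with scale `σ k`. The samples are independent over agents, times and
indices, the noises are independent over agents and times, and the samples and the noises are
independent of each other. -/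
structure IsRandomInput {n d : ℕ} (Q : Problem n d) (σ : ℕ → ℝ)
    {Ω : Type*} [MeasurableSpace Ω] (P : Measure Ω)
    (ξ : (p : Fin n × ℕ × ℕ) → Ω → Q.Sample p.1) (N : Fin n × ℕ → Ω → Vec d) : Prop where
  measurable_sample : ∀ p, Measurable (ξ p)
  measurable_noise : ∀ p, Measurable (N p)
  law_sample : ∀ p, P.map (ξ p) = Q.D p.1
  law_noise : ∀ p c, P.map (fun ω => N p ω c) = laplaceMeasure (σ p.2)
  indep_sample : iIndepFun ξ P
  indep_noise : iIndepFun N P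
  indep_sample_noise : IndepFun (fun ω p => ξ p ω) (fun ω p => N p ω) P

section Algorithm

variable {n d : ℕ} (Q : Problem n d) (A : Matrix (Fin n) (Fin n) ℝ) (α β : ℕ → ℝ) (γ : ℕ → ℕ)
  (x₀ : Fin n → Vec d) {Ω : Type*}
  (ξ : (p : Fin n × ℕ × ℕ) → Ω → Q.Sample p.1) (N : Fin n × ℕ → Ω → Vec d)

/-- The average of the `γ k` gradients that agent `i` samples at the point `x` at time `k`. -/
def avgGrad (i : Fin n) (k : ℕ) (x : Vec d) (ω : Ω) : Vec d :=
  (γ k : ℝ)⁻¹ • ∑ l ∈ range (γ k), Q.g i x (ξ (i, k, l) ω)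

/-- The gradient-perturbation algorithm: `iterate k ω i` is the state of agent `i` at time `k`. -/
def iterate : ℕ → Ω → Fin n → Vec d
  | 0, _, i => x₀ i
  | k + 1, ω, i =>
      (1 - β k) • iterate k ω i + β k • ∑ j, A i j • iterate k ω j
        - α k • (avgGrad Q γ ξ i k (iterate k ω i) ω + N (i, k) ω)

/-- The states at time `k` are `τ`-optimal: `E ‖x_{i,k} - xs‖² ≤ τ` for all agents `i`. -/
def IsAccurateAt [MeasurableSpace Ω] (P : Measure Ω) (xs : Vec d) (τ : ℝ) (k : ℕ) : Prop :=
  ∀ i, Integrable (fun ω => ‖iterate Q A α β γ x₀ ξ N k ω i - xs‖ ^ 2) P ∧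
    ∫ ω, ‖iterate Q A α β γ x₀ ξ N k ω i - xs‖ ^ 2 ∂P ≤ τ

end Algorithm

end PrivateDSO

end

/-! Track the total error V_k = ∑_i E‖x_{i,k} - x*‖². The proof derives one scalar recursion for
V_k, with no separate recursion for the consensus error. The stochastic error of a step is centred
given the current states, hence uncorrelated with the noiseless step; it adds only a term of order
α_k²(1 + σ_k²) (`exists_error_recursion`). For the noiseless step
(`IsWeightMatrix.exists_drift_le`), strong convexity contracts by 1 - 2μα up to O(αβ + α²). The
local gradients at x* need not vanish, but they sum to zero, so the linear term they create only
sees the disagreement of the agents. Mixing lowers the sum of squares by at least βD, where D is the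
loss under full mixing by A, and connectedness bounds squared disagreement by a multiple of D. Since
2α√(CD)H ≤ βD + CH²α²/β, this gain pays for the disagreement at the price α²/β. With the given step
sizes the source terms are O(k^(-1.5+4ε)), while kα_k grows like k^ε. Chung's lemma then gives V_k =
O(k^(-(0.5-4ε))). Inverting this rate bounds the hitting time, and summing the batch sizes, of order
k^ε, gives the complexity. -/

noncomputable section

namespace PrivateDSO

/-! ### Deterministic analysis of one step: mixing, disagreement and drift. -/

section Consensus

variable {E : Type*} [NormedAddCommGroup E] [InnerProductSpace ℝ E] {n : ℕ}
  {G : SimpleGraph (Fin n)} {A : Matrix (Fin n) (Fin n) ℝ}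

/-- A weighted mean has smaller norm than the data, by the weighted variance. -/
theorem sum_mul_norm_sub_sq {ι : Type*} [Fintype ι] (w : ι → ℝ) (hw : ∑ j, w j = 1) (v : ι → E) :
    ∑ j, w j * ‖v j - ∑ l, w l • v l‖ ^ 2
      = ∑ j, w j * ‖v j‖ ^ 2 - ‖∑ l, w l • v l‖ ^ 2 := by
  set m := ∑ l, w l • v l with hm
  have h1 : ∑ j, w j * inner ℝ (v j) m = ‖m‖ ^ 2 := by
    rw [← real_inner_self_eq_norm_sq]
    conv_rhs => rw [hm, sum_inner]
    exact sum_congr rfl fun j _ => by rw [real_inner_smul_left]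
  calc ∑ j, w j * ‖v j - m‖ ^ 2
      = ∑ j, (w j * ‖v j‖ ^ 2 - 2 * (w j * inner ℝ (v j) m) + w j * ‖m‖ ^ 2) :=
        sum_congr rfl fun j _ => by rw [norm_sub_sq_real]; ring
    _ = _ := by
        rw [sum_add_distrib, sum_sub_distrib, ← mul_sum, ← sum_mul, h1, hw]; ring

theorem IsWeightMatrix.nonneg (hA : IsWeightMatrix G A) (i j : Fin n) : 0 ≤ A i j := by
  obtain ⟨η, hη, h⟩ := hA.lower
  by_cases hij : i = j ∨ G.Adj i j
  · exact hη.le.trans (h i j hij).le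
  · exact (hA.zero i j hij).ge

/-- Mixing with the weights does not increase the sum of squares; the loss is the total variance of
the rows. -/
theorem IsWeightMatrix.sum_variance (hA : IsWeightMatrix G A) (v : Fin n → E) :
    ∑ i, ∑ j, A i j * ‖v j - ∑ l, A i l • v l‖ ^ 2
      = ∑ i, ‖v i‖ ^ 2 - ∑ i, ‖∑ j, A i j • v j‖ ^ 2 := by
  have h : ∀ i, ∑ j, A i j * ‖v j - ∑ l, A i l • v l‖ ^ 2
      = ∑ j, A i j * ‖v j‖ ^ 2 - ‖∑ j, A i j • v j‖ ^ 2 := fun i =>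
    sum_mul_norm_sub_sq (fun j => A i j) (hA.row_sum i) v
  simp_rw [h]
  rw [sum_sub_distrib, sum_comm]
  simp_rw [← sum_mul, hA.col_sum, one_mul]

/-- Row i gives weight above η both to i itself and to its neighbour j, so its variance controls the
distance of both `v i` and `v j` to the row mean. The total of the row variances is the loss. -/
theorem IsWeightMatrix.exists_adj_norm_sub_sq_le (hA : IsWeightMatrix G A) :
    ∃ C : ℝ, 0 < C ∧ ∀ (v : Fin n → E) (i j : Fin n), G.Adj i j →
      ‖v i - v j‖ ^ 2 ≤ C * (∑ i, ‖v i‖ ^ 2 - ∑ i, ‖∑ j, A i j • v j‖ ^ 2) := by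
  obtain ⟨η, hη, hlow⟩ := hA.lower
  refine ⟨2 / η, by positivity, fun v i j hij => ?_⟩
  rw [← hA.sum_variance v]
  set m := ∑ l, A i l • v l with hm
  have hnn : ∀ i' j', 0 ≤ A i' j' * ‖v j' - ∑ l, A i' l • v l‖ ^ 2 := fun i' j' =>
    mul_nonneg (hA.nonneg _ _) (sq_nonneg _)
  have h1 : ∑ j', A i j' * ‖v j' - m‖ ^ 2
      ≤ ∑ i', ∑ j', A i' j' * ‖v j' - ∑ l, A i' l • v l‖ ^ 2 :=
    single_le_sum (f := fun i' => ∑ j', A i' j' * ‖v j' - ∑ l, A i' l • v l‖ ^ 2)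
      (fun i' _ => sum_nonneg fun j' _ => hnn i' j') (mem_univ i)
  have h2 : ∑ j' ∈ ({i, j} : Finset (Fin n)), A i j' * ‖v j' - m‖ ^ 2
      ≤ ∑ j', A i j' * ‖v j' - m‖ ^ 2 :=
    sum_le_sum_of_subset_of_nonneg (subset_univ _) fun j' _ _ => hnn i j'
  rw [sum_pair hij.ne] at h2
  have h3 : ‖v i - v j‖ ^ 2 ≤ 2 * (‖v i - m‖ ^ 2 + ‖v j - m‖ ^ 2) := by
    have : ‖v i - v j‖ ≤ ‖v i - m‖ + ‖v j - m‖ := by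
      have := norm_sub_le (v i - m) (v j - m)
      rwa [sub_sub_sub_cancel_right] at this
    nlinarith [norm_nonneg (v i - v j), sq_nonneg (‖v i - m‖ - ‖v j - m‖)]
  have h4 : η * ‖v i - m‖ ^ 2 ≤ A i i * ‖v i - m‖ ^ 2 :=
    mul_le_mul_of_nonneg_right (hlow i i (.inl rfl)).le (sq_nonneg _)
  have h5 : η * ‖v j - m‖ ^ 2 ≤ A i j * ‖v j - m‖ ^ 2 :=
    mul_le_mul_of_nonneg_right (hlow i j (.inr hij)).le (sq_nonneg _)
  rw [div_mul_eq_mul_div, le_div_iff₀ hη]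
  nlinarith

/-- On a connected graph the disagreement between any two agents is controlled by the loss of the sum
of squares under mixing. -/
theorem IsWeightMatrix.exists_norm_sub_sq_le (hA : IsWeightMatrix G A) :
    ∃ C : ℝ, 0 < C ∧ ∀ (v : Fin n → E) (i j : Fin n),
      ‖v i - v j‖ ^ 2 ≤ C * (∑ i, ‖v i‖ ^ 2 - ∑ i, ‖∑ j, A i j • v j‖ ^ 2) := by
  obtain ⟨C, hC, h⟩ := hA.exists_adj_norm_sub_sq_le (E := E)
  -- A path has fewer than n edges, so chaining the edge bound costs a factor n, squared; the +1
  -- makes positivity immediate.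
  refine ⟨(n : ℝ) ^ 2 * C + 1, by positivity, fun v i j => ?_⟩
  set D := ∑ i, ‖v i‖ ^ 2 - ∑ i, ‖∑ j, A i j • v j‖ ^ 2 with hD
  have hD0 : 0 ≤ D := by
    rw [hD, ← hA.sum_variance v]
    exact sum_nonneg fun _ _ => sum_nonneg fun _ _ => mul_nonneg (hA.nonneg _ _) (sq_nonneg _)
  have hwalk : ∀ {i j : Fin n} (p : G.Walk i j), ‖v i - v j‖ ≤ p.length * √(C * D) := by
    intro i j p
    induction p with
    | nil => simp
    | @cons u w z huw p ih =>
      have h1 : ‖v u - v w‖ ≤ √(C * D) := Real.le_sqrt_of_sq_le (h v u w huw)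
      have h2 := norm_sub_le_norm_sub_add_norm_sub (v u) (v w) (v z)
      rw [SimpleGraph.Walk.length_cons]
      push_cast
      linarith
  obtain ⟨p, hp⟩ := (hA.connected.preconnected i j).exists_isPath
  have hlen : (p.length : ℝ) ≤ n := by
    have := hp.length_lt
    rw [Fintype.card_fin] at this
    exact_mod_cast this.le
  have h1 : ‖v i - v j‖ ≤ n * √(C * D) :=
    (hwalk p).trans (mul_le_mul_of_nonneg_right hlen (Real.sqrt_nonneg _))
  calc ‖v i - v j‖ ^ 2 ≤ (n * √(C * D)) ^ 2 := by gcongr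
    _ = (n : ℝ) ^ 2 * C * D := by rw [mul_pow, Real.sq_sqrt (by positivity)]; ring
    _ ≤ _ := by nlinarith

theorem norm_convexCombination_sq_le {t : ℝ} (h0 : 0 ≤ t) (h1 : t ≤ 1) (x y : E) :
    ‖(1 - t) • x + t • y‖ ^ 2 ≤ (1 - t) * ‖x‖ ^ 2 + t * ‖y‖ ^ 2 := by
  have h2 := norm_add_sq_real ((1 - t) • x) (t • y)
  rw [real_inner_smul_left, real_inner_smul_right, norm_smul, norm_smul, mul_pow, mul_pow,
    Real.norm_eq_abs, Real.norm_eq_abs, sq_abs, sq_abs] at h2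
  have h3 := norm_sub_sq_real x y
  nlinarith [mul_nonneg (mul_nonneg h0 (sub_nonneg.2 h1)) (sq_nonneg ‖x - y‖)]

/-- AM-GM weighted so that the coefficient of D is exactly β, the amount gained by mixing; the
defect is a perfect square over Cβ. -/
theorem two_mul_sqrt_mul_le {C D β : ℝ} (hC : 0 < C) (hD : 0 ≤ D) (H α : ℝ) (hβ : 0 < β) :
    2 * α * (√(C * D) * H) ≤ β * D + C * H ^ 2 * (α ^ 2 / β) := by
  have h1 : √(C * D) ^ 2 = C * D := Real.sq_sqrt (by positivity)
  generalize √(C * D) = s at h1 ⊢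
  obtain rfl : D = s ^ 2 / C := by rw [h1]; field_simp
  have h2 : β * (s ^ 2 / C) + C * H ^ 2 * (α ^ 2 / β) - 2 * α * (s * H)
      = (β * s - C * H * α) ^ 2 / (C * β) := by
    field_simp
    ring
  have h3 : 0 ≤ (β * s - C * H * α) ^ 2 / (C * β) := by positivity
  linarith

/-- The one-step bound for a single agent: `v` is its error, `a` the weighted mean of the errors of its
neighbours, `h` its gradient and `h'` its gradient at the optimum. -/
theorem norm_step_sq_le {α β L μ : ℝ} (hL : 0 ≤ L) (hα : 0 < α) (hβ : 0 < β) {v a h h' : E}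
    (hlip : ‖h - h'‖ ≤ L * ‖v‖) (hstr : μ * ‖v‖ ^ 2 ≤ inner ℝ (h - h') v) :
    ‖(1 - β) • v + β • a - α • h‖ ^ 2 ≤ ‖(1 - β) • v + β • a‖ ^ 2
      - 2 * α * inner ℝ ((1 - β) • v + β • a) h'
      - 2 * α * μ * ‖v‖ ^ 2 + α * β * L * (3 * ‖v‖ ^ 2 + 2 * ‖a‖ ^ 2)
      + α ^ 2 * (2 * L ^ 2 * ‖v‖ ^ 2 + 2 * ‖h'‖ ^ 2) := by
  have hcross : -(L / 2 * (3 * ‖v‖ ^ 2 + 2 * ‖a‖ ^ 2)) ≤ inner ℝ (a - v) (h - h') := by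
    have h1 := neg_le_of_abs_le (abs_real_inner_le_norm (a - v) (h - h'))
    have h2 : ‖a - v‖ * ‖h - h'‖ ≤ (‖a‖ + ‖v‖) * (L * ‖v‖) :=
      mul_le_mul (norm_sub_le _ _) hlip (norm_nonneg _) (by positivity)
    have h3 : (‖a‖ + ‖v‖) * ‖v‖ ≤ 1 / 2 * (3 * ‖v‖ ^ 2 + 2 * ‖a‖ ^ 2) := by
      nlinarith [sq_nonneg (‖a‖ - ‖v‖), sq_nonneg ‖a‖]
    nlinarith [mul_le_mul_of_nonneg_left h3 hL]
  have hsq : ‖h‖ ^ 2 ≤ 2 * L ^ 2 * ‖v‖ ^ 2 + 2 * ‖h'‖ ^ 2 := by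
    have h1 : ‖h‖ ≤ L * ‖v‖ + ‖h'‖ := by
      have := norm_add_le (h - h') h'
      rw [sub_add_cancel] at this
      linarith
    have h2 : ‖h‖ ^ 2 ≤ (L * ‖v‖ + ‖h'‖) ^ 2 := by gcongr
    nlinarith [sq_nonneg (L * ‖v‖ - ‖h'‖)]
  -- Strong convexity applies at the state v, not at the mixed point v + β(a - v); the mismatch
  -- carries a factor β and ends up in the αβ term.
  have h1 : inner ℝ ((1 - β) • v + β • a) h = inner ℝ ((1 - β) • v + β • a) h'
      + inner ℝ (h - h') v + β * inner ℝ (a - v) (h - h') := by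
    have h2 : (1 - β) • v + β • a = v + β • (a - v) := by module
    rw [h2, real_inner_comm v, ← real_inner_smul_left, add_assoc, ← inner_add_left, ← inner_add_right,
      add_sub_cancel]
  rw [norm_sub_sq_real, real_inner_smul_right, norm_smul, mul_pow, Real.norm_eq_abs, sq_abs, h1]
  nlinarith [mul_le_mul_of_nonneg_left hstr hα.le, mul_le_mul_of_nonneg_left hsq (sq_nonneg α),
    mul_le_mul_of_nonneg_left hcross (mul_pos hα hβ).le]

/-- The mean drift along gradients that sum to zero is controlled by the disagreement `r`. -/
theorem IsWeightMatrix.neg_mul_le_sum_inner (hA : IsWeightMatrix G A) {β r : ℝ} (hβ : 0 ≤ β)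
    (hβ1 : β ≤ 1) {v : Fin n → E} (hr : ∀ i j, ‖v i - v j‖ ≤ r) (h' : Fin n → E)
    (hsum : ∑ i, h' i = 0) :
    -(r * ∑ i, ‖h' i‖) ≤ ∑ i, inner ℝ ((1 - β) • v i + β • ∑ j, A i j • v j) (h' i) := by
  obtain ⟨o⟩ := hA.connected.nonempty
  have hav : ∀ i, ‖(∑ j, A i j • v j) - v o‖ ≤ r := fun i => by
    have : (∑ j, A i j • v j) - v o = ∑ j, A i j • (v j - v o) := by
      simp_rw [smul_sub, sum_sub_distrib, ← sum_smul, hA.row_sum, one_smul]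
    rw [this]
    calc ‖∑ j, A i j • (v j - v o)‖ ≤ ∑ j, A i j * r := norm_sum_le_of_le _ fun j _ => by
          rw [norm_smul, Real.norm_of_nonneg (hA.nonneg _ _)]
          exact mul_le_mul_of_nonneg_left (hr _ _) (hA.nonneg _ _)
      _ = r := by rw [← sum_mul, hA.row_sum, one_mul]
  have huv : ∀ i, ‖(1 - β) • v i + β • (∑ j, A i j • v j) - v o‖ ≤ r := fun i => by
    have : (1 - β) • v i + β • (∑ j, A i j • v j) - v o
        = (1 - β) • (v i - v o) + β • ((∑ j, A i j • v j) - v o) := by module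
    rw [this]
    refine (norm_add_le _ _).trans ?_
    rw [norm_smul, norm_smul, Real.norm_of_nonneg hβ, Real.norm_of_nonneg (sub_nonneg.2 hβ1)]
    have h1 := mul_le_mul_of_nonneg_left (hr i o) (sub_nonneg.2 hβ1)
    have h2 := mul_le_mul_of_nonneg_left (hav i) hβ
    linarith
  -- As the `h' i` sum to zero, the state of the reference agent o can be subtracted for free,
  -- leaving only disagreements.
  have heq : ∑ i, inner ℝ ((1 - β) • v i + β • ∑ j, A i j • v j) (h' i)
      = ∑ i, inner ℝ ((1 - β) • v i + β • (∑ j, A i j • v j) - v o) (h' i) := by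
    simp_rw [inner_sub_left, sum_sub_distrib, ← inner_sum, hsum, inner_zero_right, sub_zero]
  rw [heq, mul_sum, ← sum_neg_distrib]
  refine sum_le_sum fun i _ => ?_
  have h1 := neg_le_of_abs_le (abs_real_inner_le_norm
    ((1 - β) • v i + β • (∑ j, A i j • v j) - v o) (h' i))
  have h2 := mul_le_mul_of_nonneg_right (huv i) (norm_nonneg (h' i))
  linarith

/-- One noiseless step of the algorithm contracts the sum of the squared errors `v i`, up to the error
`α ^ 2 / β` caused by the disagreement of the agents. Here `h i` is the gradient of agent `i` at its
state and `h' i` its gradient at the optimum. -/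
theorem IsWeightMatrix.exists_drift_le (hA : IsWeightMatrix G A) (L μ : ℝ) (hL : 0 ≤ L)
    (h' : Fin n → E) (hsum : ∑ i, h' i = 0) :
    ∃ C : ℝ, 0 < C ∧ ∀ (α β : ℝ) (v h : Fin n → E), 0 < α → 0 < β → β ≤ 1 →
      (∀ i, ‖h i - h' i‖ ≤ L * ‖v i‖) → (∀ i, μ * ‖v i‖ ^ 2 ≤ inner ℝ (h i - h' i) (v i)) →
      ∑ i, ‖(1 - β) • v i + β • (∑ j, A i j • v j) - α • h i‖ ^ 2
        ≤ (1 - 2 * μ * α + C * (α * β + α ^ 2)) * ∑ i, ‖v i‖ ^ 2 + C * (α ^ 2 / β + α ^ 2) := by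
  obtain ⟨C, hC, hcons⟩ := hA.exists_norm_sub_sq_le (E := E)
  set H := ∑ i, ‖h' i‖ with hH
  have hH0 : 0 ≤ H := sum_nonneg fun _ _ => norm_nonneg _
  set H2 := ∑ i, ‖h' i‖ ^ 2 with hH2
  have hH20 : 0 ≤ H2 := sum_nonneg fun _ _ => sq_nonneg _
  -- One constant dominating four coefficients: 5L for αβV (3 + 2, using ∑‖a i‖² ≤ V), 2L² for α²V,
  -- CH² for α²/β and 2H2 for α².
  refine ⟨5 * L + 2 * L ^ 2 + C * H ^ 2 + 2 * H2 + 1, by positivity,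
    fun α β v h hα hβ hβ1 hlip hstr => ?_⟩
  set a : Fin n → E := fun i => ∑ j, A i j • v j with ha
  set V := ∑ i, ‖v i‖ ^ 2 with hV
  have hV0 : 0 ≤ V := sum_nonneg fun _ _ => sq_nonneg _
  set D := V - ∑ i, ‖a i‖ ^ 2 with hD
  have hcons' : ∀ i j, ‖v i - v j‖ ≤ √(C * D) := fun i j =>
    Real.le_sqrt_of_sq_le (hcons v i j)
  have hD0 : 0 ≤ D := by
    obtain ⟨i⟩ := hA.connected.nonempty
    have := (sq_nonneg _).trans (hcons v i i)
    exact nonneg_of_mul_nonneg_right this hC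
  set u : Fin n → E := fun i => (1 - β) • v i + β • a i with hu
  have hu2 : ∑ i, ‖u i‖ ^ 2 ≤ V - β * D := by
    calc ∑ i, ‖u i‖ ^ 2 ≤ ∑ i, ((1 - β) * ‖v i‖ ^ 2 + β * ‖a i‖ ^ 2) :=
          sum_le_sum fun i _ => norm_convexCombination_sq_le hβ.le hβ1 _ _
      _ = V - β * D := by rw [sum_add_distrib, ← mul_sum, ← mul_sum, hD]; ring
  have hopt := hA.neg_mul_le_sum_inner (v := v) hβ.le hβ1 hcons' h' hsum
  have ha2 : ∑ i, ‖a i‖ ^ 2 ≤ V := by linarith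
  have hstep : ∀ i, ‖u i - α • h i‖ ^ 2 ≤ ‖u i‖ ^ 2 - 2 * α * inner ℝ (u i) (h' i)
      - 2 * α * μ * ‖v i‖ ^ 2 + α * β * L * (3 * ‖v i‖ ^ 2 + 2 * ‖a i‖ ^ 2)
      + α ^ 2 * (2 * L ^ 2 * ‖v i‖ ^ 2 + 2 * ‖h' i‖ ^ 2) := fun i =>
    norm_step_sq_le hL hα hβ (hlip i) (hstr i)
  have htotal : ∑ i, ‖u i - α • h i‖ ^ 2 ≤ ∑ i, ‖u i‖ ^ 2 - 2 * α * ∑ i, inner ℝ (u i) (h' i)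
      - 2 * α * μ * V + α * β * L * (3 * V + 2 * ∑ i, ‖a i‖ ^ 2)
      + α ^ 2 * (2 * L ^ 2 * V + 2 * H2) := by
    refine (sum_le_sum fun i _ => hstep i).trans_eq ?_
    simp only [sum_add_distrib, sum_sub_distrib, ← mul_sum]
    rfl
  -- The term βD produced here cancels the -βD of `hu2`.
  have hamgm := two_mul_sqrt_mul_le hC hD0 H α hβ
  have hαβ := mul_pos hα hβ
  have hdiv : 0 ≤ α ^ 2 / β := by positivity
  have e1 : α * β * L * (3 * V + 2 * ∑ i, ‖a i‖ ^ 2) ≤ 5 * L * (α * β * V) := by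
    nlinarith [mul_le_mul_of_nonneg_left ha2 (mul_nonneg hαβ.le hL)]
  have e2 : 2 * α * -(√(C * D) * H) ≤ 2 * α * ∑ i, inner ℝ (u i) (h' i) :=
    mul_le_mul_of_nonneg_left hopt (by positivity)
  have p1 : 0 ≤ α * β * V := by positivity
  have p2 : 0 ≤ α ^ 2 * V := by positivity
  have p3 : 0 ≤ C * H ^ 2 := by positivity
  calc _ ≤ V - 2 * μ * α * V + 5 * L * (α * β * V) + 2 * L ^ 2 * (α ^ 2 * V)
        + (C * H ^ 2 * (α ^ 2 / β) + 2 * H2 * α ^ 2) := by linarith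
    _ ≤ V - 2 * μ * α * V + (5 * L + 2 * L ^ 2 + C * H ^ 2 + 2 * H2 + 1) * (α * β * V + α ^ 2 * V)
        + (5 * L + 2 * L ^ 2 + C * H ^ 2 + 2 * H2 + 1) * (α ^ 2 / β + α ^ 2) := by
        have q1 : 5 * L * (α * β * V) ≤ (5 * L + 2 * L ^ 2 + C * H ^ 2 + 2 * H2 + 1) * (α * β * V) :=
          mul_le_mul_of_nonneg_right (by linarith [sq_nonneg L]) p1
        have q2 : 2 * L ^ 2 * (α ^ 2 * V)
            ≤ (5 * L + 2 * L ^ 2 + C * H ^ 2 + 2 * H2 + 1) * (α ^ 2 * V) :=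
          mul_le_mul_of_nonneg_right (by linarith [sq_nonneg L]) p2
        have q3 : C * H ^ 2 * (α ^ 2 / β)
            ≤ (5 * L + 2 * L ^ 2 + C * H ^ 2 + 2 * H2 + 1) * (α ^ 2 / β) :=
          mul_le_mul_of_nonneg_right (by linarith [sq_nonneg L]) hdiv
        have q4 : 2 * H2 * α ^ 2 ≤ (5 * L + 2 * L ^ 2 + C * H ^ 2 + 2 * H2 + 1) * α ^ 2 :=
          mul_le_mul_of_nonneg_right (by linarith [sq_nonneg L]) (sq_nonneg α)
        linarith
    _ = _ := by ring

end Consensus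

/-! ### Scalar recursions, decay rates and sample counts. -/

open Filter Topology in
/-- Chung's lemma, for step sizes that dominate `2 / k`. -/
theorem exists_le_mul_rpow_neg {V c : ℕ → ℝ} {p C : ℝ} (hV : ∀ k, 0 ≤ V k)
    (hp1 : p ≤ 1) (hC : 0 ≤ C)
    (hrec : ∀ᶠ k in atTop, V (k + 1) ≤ (1 - c k) * V k + C * ((k : ℝ) + 1) ^ (-p) / ((k : ℝ) + 1))
    (hc1 : ∀ᶠ k in atTop, c k ≤ 1) (hc2 : ∀ᶠ k : ℕ in atTop, 2 ≤ c k * ((k : ℝ) + 1)) :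
    ∃ B : ℝ, 0 < B ∧ ∀ k : ℕ, V k ≤ B * ((k : ℝ) + 1) ^ (-p) := by
  obtain ⟨k₀, hk₀⟩ := eventually_atTop.1 (hrec.and (hc1.and hc2))
  set S := ∑ k ∈ range (k₀ + 1), V k * ((k : ℝ) + 1) ^ p with hS
  have hnn : ∀ k : ℕ, 0 ≤ V k * ((k : ℝ) + 1) ^ p := fun k => mul_nonneg (hV k) (by positivity)
  have hS0 : 0 ≤ S := sum_nonneg fun k _ => hnn k
  refine ⟨S + C + 1, by positivity, fun k => ?_⟩
  have hsmall : ∀ k ≤ k₀, V k ≤ (S + C + 1) * ((k : ℝ) + 1) ^ (-p) := fun k hk => by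
    have h1 : V k * ((k : ℝ) + 1) ^ p ≤ S :=
      single_le_sum (f := fun k : ℕ => V k * ((k : ℝ) + 1) ^ p) (fun k _ => hnn k)
        (mem_range.2 (Nat.lt_succ_of_le hk))
    rw [Real.rpow_neg (by positivity), ← div_eq_mul_inv, le_div_iff₀ (by positivity)]
    linarith
  rcases le_total k k₀ with hk | hk
  · exact hsmall k hk
  induction k, hk using Nat.le_induction with
  | base => exact hsmall _ le_rfl
  | succ k hk ih =>
    obtain ⟨h1, h2, h3⟩ := hk₀ k hk
    set B := S + C + 1 with hB
    have hCB : C ≤ B := by linarith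
    set x : ℝ := (k : ℝ) + 1 with hx
    have hx0 : 0 < x := by positivity
    set y := x ^ (-p) with hy
    have hy0 : 0 < y := by positivity
    -- The damping is at least 2/x; one 1/x absorbs the source because C ≤ B, and the other drives
    -- the decay from x^(-p) to (x+1)^(-p), where p ≤ 1 is used.
    have h4 : V (k + 1) ≤ B * (y * (1 - 1 / x)) := by
      have h5 : (1 - c k) * V k ≤ (1 - c k) * (B * y) :=
        mul_le_mul_of_nonneg_left ih (sub_nonneg.2 h2)
      have h6 : 2 / x ≤ c k := by rwa [div_le_iff₀ hx0]
      have h7 : C * y / x ≤ B * y * (1 / x) := by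
        rw [mul_one_div]; gcongr
      have h8 : B * y * (2 / x) ≤ B * y * c k := by gcongr
      have h9 : B * y * (2 / x) = 2 * (B * y * (1 / x)) := by ring
      linarith
    refine h4.trans ?_
    push_cast
    rw [← hx]
    refine mul_le_mul_of_nonneg_left ?_ (by positivity)
    have h5 : x / (x + 1) ≤ (x / (x + 1)) ^ p := by
      refine Real.self_le_rpow_of_le_one (by positivity) ?_ hp1
      rw [div_le_one (by positivity)]; linarith
    have h6 : 1 - 1 / x ≤ x / (x + 1) := by
      rw [le_div_iff₀ (by positivity)]
      have : (1 - 1 / x) * (x + 1) = x - 1 / x := by field_simp; ring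
      rw [this]
      linarith [one_div_pos.2 hx0]
    calc y * (1 - 1 / x) ≤ y * (x / (x + 1)) ^ p := by gcongr; exact h6.trans h5
      _ = (x + 1) ^ (-p) := by
        rw [hy, Real.div_rpow hx0.le (by positivity), Real.rpow_neg hx0.le,
          Real.rpow_neg (by positivity)]
        field_simp

open Filter Topology in
/-- The decay rate of a sequence driven by the step sizes of the algorithm. -/
theorem exists_le_rpow_of_recursion {V α β σ : ℕ → ℝ} {a b ε μ C : ℝ} (ha : 0 < a) (ha' : a < 1)
    (hε : 0 < ε) (hε' : ε < 1 / 8) (hμ : 0 < μ) (hC : 0 ≤ C)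
    (hα : ∀ k : ℕ, α k = a / ((k : ℝ) + 1) ^ (1 - ε))
    (hβ : ∀ k : ℕ, β k = a / ((k : ℝ) + 1) ^ (0.5 + ε))
    (hσ : ∀ k : ℕ, σ k = b * ((k : ℝ) + 1) ^ ε)
    (hV : ∀ k, 0 ≤ V k)
    (hrec : ∀ k, V (k + 1) ≤ (1 - 2 * μ * α k + C * (α k * β k + α k ^ 2)) * V k
      + C * (α k ^ 2 / β k + α k ^ 2 * (1 + σ k ^ 2))) :
    ∃ B : ℝ, 0 < B ∧ ∀ k : ℕ, V k ≤ B * ((k : ℝ) + 1) ^ (-(0.5 - 4 * ε)) := by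
  have hcast : Tendsto (fun k : ℕ => (k : ℝ) + 1) atTop atTop :=
    tendsto_atTop_add_const_right _ _ tendsto_natCast_atTop_atTop
  have hlim : ∀ s : ℝ, 0 < s → Tendsto (fun k : ℕ => a / ((k : ℝ) + 1) ^ s) atTop (𝓝 0) :=
    fun s hs => ((tendsto_rpow_atTop hs).comp hcast).const_div_atTop a
  have hα0 : Tendsto α atTop (𝓝 0) := by
    rw [funext hα]; exact hlim _ (by linarith)
  have hβ0 : Tendsto β atTop (𝓝 0) := by
    rw [funext hβ]; exact hlim _ (by linarith)
  -- Half of the damping 2μα is kept; the other half eventually absorbs C(αβ + α²) ≤ 2Cαβ. The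
  -- factor 2 + b² collects the three source terms.
  refine exists_le_mul_rpow_neg (c := fun k => μ * α k) (C := C * (2 + b ^ 2)) hV
    (by linarith) (by positivity) ?_ ?_ ?_
  · have hev : ∀ᶠ k in atTop, 2 * C * β k ≤ μ := by
      have : Tendsto (fun k => 2 * C * β k) atTop (𝓝 (2 * C * 0)) := hβ0.const_mul _
      rw [mul_zero] at this
      exact (this.eventually (gt_mem_nhds hμ)).mono fun k hk => hk.le
    filter_upwards [hev] with k hk
    set x : ℝ := (k : ℝ) + 1 with hx
    have hx1 : 1 ≤ x := by rw [hx]; linarith [Nat.cast_nonneg (α := ℝ) k]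
    have hx0 : 0 < x := by positivity
    have hα' : α k = a * x ^ (-(1 - ε)) := by rw [hα, ← hx, Real.rpow_neg hx0.le]; rfl
    have hβ' : β k = a * x ^ (-(0.5 + ε)) := by rw [hβ, ← hx, Real.rpow_neg hx0.le]; rfl
    have hσ' : σ k = b * x ^ ε := hσ k
    have hαpos : 0 < α k := by rw [hα']; positivity
    have hβpos : 0 < β k := by rw [hβ']; positivity
    have hαβ : α k ≤ β k := by
      rw [hα', hβ']
      exact mul_le_mul_of_nonneg_left (Real.rpow_le_rpow_of_exponent_le hx1 (by linarith)) ha.le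
    set z := x ^ (-(0.5 - 4 * ε)) / x with hz
    have hz' : z = x ^ (-1.5 + 4 * ε) := by
      rw [hz, ← Real.rpow_sub_one hx0.ne']; norm_num; ring_nf
    have hz0 : 0 < z := by positivity
    have ha2 : a ^ 2 ≤ 1 := by nlinarith
    -- The slowest source term: its exponent -2(1-ε) + (0.5+ε) = -1.5 + 3ε leaves a slack of ε.
    have t1 : α k ^ 2 / β k ≤ z := by
      have : α k ^ 2 / β k = a * x ^ (-1.5 + 3 * ε) := by
        rw [div_eq_iff hβpos.ne', hα', hβ', mul_pow, ← Real.rpow_natCast (x ^ _),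
          ← Real.rpow_mul hx0.le, mul_mul_mul_comm, ← Real.rpow_add hx0, sq]
        congr 2
        push_cast; ring
      rw [this, hz']
      calc a * x ^ (-1.5 + 3 * ε) ≤ 1 * x ^ (-1.5 + 4 * ε) := by
            gcongr ?_ * ?_
            exact Real.rpow_le_rpow_of_exponent_le hx1 (by linarith)
        _ = _ := one_mul _
    have t2 : α k ^ 2 ≤ z := by
      have : α k ^ 2 = a ^ 2 * x ^ (-2 + 2 * ε) := by
        rw [hα', mul_pow, ← Real.rpow_natCast (x ^ _), ← Real.rpow_mul hx0.le]
        congr 2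
        push_cast; ring
      rw [this, hz']
      calc a ^ 2 * x ^ (-2 + 2 * ε) ≤ 1 * x ^ (-1.5 + 4 * ε) := by
            gcongr ?_ * ?_
            exact Real.rpow_le_rpow_of_exponent_le hx1 (by linarith)
        _ = _ := one_mul _
    have t3 : α k ^ 2 * σ k ^ 2 ≤ b ^ 2 * z := by
      have : α k ^ 2 * σ k ^ 2 = b ^ 2 * (a ^ 2 * x ^ (-2 + 4 * ε)) := by
        have : x ^ (-2 + 4 * ε) = (x ^ (-(1 - ε)) * x ^ ε) ^ 2 := by
          rw [← Real.rpow_add hx0, ← Real.rpow_natCast (x ^ _), ← Real.rpow_mul hx0.le]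
          congr 1
          push_cast; ring
        rw [hα', hσ', this]; ring
      rw [this, hz']
      refine mul_le_mul_of_nonneg_left ?_ (sq_nonneg b)
      calc a ^ 2 * x ^ (-2 + 4 * ε) ≤ 1 * x ^ (-1.5 + 4 * ε) := by
            gcongr ?_ * ?_
            exact Real.rpow_le_rpow_of_exponent_le hx1 (by linarith)
        _ = _ := one_mul _
    refine (hrec k).trans (add_le_add ?_ ?_)
    · refine mul_le_mul_of_nonneg_right ?_ (hV k)
      have h1 : C * (α k * β k + α k ^ 2) ≤ C * (2 * (α k * β k)) := by
        refine mul_le_mul_of_nonneg_left ?_ hC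
        nlinarith
      nlinarith
    · rw [mul_div_assoc, mul_assoc]
      refine mul_le_mul_of_nonneg_left ?_ hC
      change _ ≤ (2 + b ^ 2) * z
      linarith
  · have : Tendsto (fun k => μ * α k) atTop (𝓝 (μ * 0)) := hα0.const_mul _
    rw [mul_zero] at this
    exact (this.eventually (gt_mem_nhds one_pos)).mono fun k hk => hk.le
  · have : Tendsto (fun k : ℕ => μ * a * ((k : ℝ) + 1) ^ ε) atTop atTop :=
      ((tendsto_rpow_atTop hε).comp hcast).const_mul_atTop (by positivity)
    filter_upwards [this.eventually_ge_atTop 2] with k hk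
    have hx0 : (0 : ℝ) < (k : ℝ) + 1 := by positivity
    have : μ * α k * ((k : ℝ) + 1) = μ * a * ((k : ℝ) + 1) ^ ε := by
      rw [hα, Real.rpow_sub hx0, Real.rpow_one]
      field_simp
    rwa [this]

/-- A decay rate `k ^ (-p)` turns into a bound on the number of samples needed for accuracy `τ`. -/
theorem exists_sum_le_rpow {a ε p B : ℝ} (ha : 0 < a) (hε : 0 < ε) (hp : 0 < p) (hB : 0 < B)
    {γ : ℕ → ℕ} (hγ : ∀ k : ℕ, γ k = ⌈a * ((k : ℝ) + 1) ^ ε⌉₊) :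
    ∃ M : ℝ, 0 < M ∧ ∀ τ : ℝ, 0 < τ → τ ≤ 1 → ∃ k₀ : ℕ, B * ((k₀ : ℝ) + 1) ^ (-p) ≤ τ ∧
      ∀ K ≤ k₀, (∑ k ∈ range (K + 1), (γ k : ℝ)) ≤ M * τ ^ (-((1 + ε) / p)) := by
  -- The summand 2 pays for the ceiling in `k₀` and for the shift K + 1, both absorbed since
  -- τ^(-1/p) ≥ 1; a + 1 pays for the ceiling in γ.
  refine ⟨(a + 1) * (B ^ (1 / p) + 2) ^ (1 + ε), by positivity, fun τ hτ hτ1 => ?_⟩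
  refine ⟨⌈(B / τ) ^ (1 / p)⌉₊, ?_, fun K hK => ?_⟩
  · set x : ℝ := (⌈(B / τ) ^ (1 / p)⌉₊ : ℝ) + 1 with hx
    have hx0 : 0 < x := by positivity
    have h1 : (B / τ) ^ (1 / p) ≤ x := (Nat.le_ceil _).trans (by linarith)
    have h2 : B / τ ≤ x ^ p := by
      have := Real.rpow_le_rpow (by positivity) h1 hp.le
      rwa [← Real.rpow_mul (by positivity), one_div_mul_cancel hp.ne', Real.rpow_one] at this
    rw [Real.rpow_neg hx0.le, ← div_eq_mul_inv, div_le_iff₀ (by positivity)]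
    rwa [div_le_iff₀ hτ, mul_comm] at h2
  · set y : ℝ := (K : ℝ) + 1 with hy
    have hy0 : 0 < y := by positivity
    have hτp : 1 ≤ τ ^ (-(1 / p)) :=
      Real.one_le_rpow_of_pos_of_le_one_of_nonpos hτ hτ1 (by
        have : 0 < 1 / p := by positivity
        linarith)
    have h1 : y ≤ (B ^ (1 / p) + 2) * τ ^ (-(1 / p)) := by
      have h2 : (K : ℝ) ≤ (⌈(B / τ) ^ (1 / p)⌉₊ : ℝ) := by exact_mod_cast hK
      have h3 := (Nat.ceil_lt_add_one (a := (B / τ) ^ (1 / p)) (by positivity)).le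
      have h4 : (B / τ) ^ (1 / p) = B ^ (1 / p) * τ ^ (-(1 / p)) := by
        rw [Real.div_rpow hB.le hτ.le, Real.rpow_neg hτ.le]; rfl
      rw [h4] at h2 h3
      nlinarith
    have hterm : ∀ k ∈ range (K + 1), (γ k : ℝ) ≤ (a + 1) * y ^ ε := fun k hk => by
      have hk' : (k : ℝ) + 1 ≤ y := by
        have : (k : ℝ) ≤ K := by exact_mod_cast Nat.lt_succ_iff.1 (mem_range.1 hk)
        linarith
      have h2 : ((k : ℝ) + 1) ^ ε ≤ y ^ ε := Real.rpow_le_rpow (by positivity) hk' hε.le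
      have h3 : 1 ≤ y ^ ε :=
        Real.one_le_rpow (by rw [hy]; linarith [Nat.cast_nonneg (α := ℝ) K]) hε.le
      have h4 := (Nat.ceil_lt_add_one (a := a * ((k : ℝ) + 1) ^ ε) (by positivity)).le
      rw [hγ]
      nlinarith
    calc (∑ k ∈ range (K + 1), (γ k : ℝ)) ≤ (K + 1 : ℕ) • ((a + 1) * y ^ ε) := by
          have := sum_le_card_nsmul _ _ _ hterm
          rwa [card_range] at this
      _ = (a + 1) * y ^ (1 + ε) := by
          rw [nsmul_eq_mul, Real.rpow_add hy0, Real.rpow_one]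
          push_cast
          rw [← hy]; ring
      _ ≤ (a + 1) * ((B ^ (1 / p) + 2) * τ ^ (-(1 / p))) ^ (1 + ε) := by gcongr
      _ = _ := by
          rw [Real.mul_rpow (by positivity) (by positivity), ← Real.rpow_mul hτ.le, ← mul_assoc]
          congr 2
          ring

/-! ### Moments of the Laplace distribution. -/

theorem integral_sq_mul_exp_neg_div {b : ℝ} (hb : 0 < b) :
    ∫ t in Set.Ioi (0 : ℝ), t ^ 2 * (Real.exp (-t / b) / (2 * b)) = b ^ 2 := by
  have h := Real.integral_rpow_mul_exp_neg_mul_Ioi (a := 3) (r := 1 / b) (by norm_num)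
    (by positivity)
  have h2 : ∀ t : ℝ, t ^ 2 * (Real.exp (-t / b) / (2 * b))
      = (1 / (2 * b)) * (t ^ ((3 : ℝ) - 1) * Real.exp (-(1 / b * t))) := fun t => by
    have : (3 : ℝ) - 1 = (2 : ℕ) := by norm_num
    rw [this, Real.rpow_natCast]
    have : -t / b = -(1 / b * t) := by ring
    rw [this]; ring
  simp_rw [h2]
  rw [integral_const_mul, h]
  have h3 : Real.Gamma 3 = 2 := by
    have : (3 : ℝ) = (2 : ℕ) + 1 := by norm_num
    rw [this, Real.Gamma_nat_eq_factorial]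
    rfl
  have h4 : (1 / (1 / b)) ^ (3 : ℝ) = b ^ 3 := by
    have : (3 : ℝ) = (3 : ℕ) := by norm_num
    rw [one_div_one_div, this, Real.rpow_natCast]
  rw [h3, h4]
  field_simp

theorem integral_laplaceMeasure {b : ℝ} (hb : 0 < b) (f : ℝ → ℝ) :
    ∫ t, f t ∂(laplaceMeasure b) = ∫ t, f t * (Real.exp (-|t| / b) / (2 * b)) := by
  rw [laplaceMeasure, integral_withDensity_eq_integral_toReal_smul (by fun_prop)
    (Filter.Eventually.of_forall fun _ => ENNReal.ofReal_lt_top)]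
  refine integral_congr_ae (Filter.Eventually.of_forall fun t => ?_)
  simp only [smul_eq_mul]
  rw [ENNReal.toReal_ofReal (by positivity), mul_comm]

theorem integral_sq_laplaceMeasure {b : ℝ} (hb : 0 < b) :
    ∫ t, t ^ 2 ∂(laplaceMeasure b) = 2 * b ^ 2 := by
  rw [integral_laplaceMeasure hb, ← integral_sq_mul_exp_neg_div hb,
    ← integral_comp_abs (f := fun t => t ^ 2 * (Real.exp (-t / b) / (2 * b)))]
  simp_rw [sq_abs]

theorem integral_id_laplaceMeasure {b : ℝ} (hb : 0 < b) :
    ∫ t, t ∂(laplaceMeasure b) = 0 := by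
  rw [integral_laplaceMeasure hb]
  have h := integral_neg_eq_self (fun t : ℝ => t * (Real.exp (-|t| / b) / (2 * b))) volume
  simp only [abs_neg, neg_mul, integral_neg] at h
  linarith

theorem memLp_id_laplaceMeasure {b : ℝ} (hb : 0 < b) :
    MemLp (fun t : ℝ => t) 2 (laplaceMeasure b) := by
  rw [memLp_two_iff_integrable_sq (by fun_prop)]
  -- A non-integrable function has Bochner integral 0, but the second moment was computed to be 2b²
  -- ≠ 0.
  by_contra h
  have h1 := integral_undef h
  rw [integral_sq_laplaceMeasure hb] at h1
  exact (by positivity : 2 * b ^ 2 ≠ 0) h1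

/-! ### Independence of the current state from fresh randomness. -/

section Independence

variable {Ω : Type*}

/-- Intersections u ∩ v form a π-system generating m₁ ⊔ m₃, and P(u ∩ v ∩ t) factors by splitting
off v first. It is used with m₁ the past of one family (samples or noises), m₂ its current member
and m₃ the past of the other. -/
theorem indep_sup_left_of_indep_sup {m₁ m₂ m₃ mΩ : MeasurableSpace Ω} {P : Measure Ω}
    [IsProbabilityMeasure P] (h₁ : m₁ ≤ mΩ) (h₂ : m₂ ≤ mΩ) (h₃ : m₃ ≤ mΩ)
    (h12 : Indep m₁ m₂ P) (h123 : Indep (m₁ ⊔ m₂) m₃ P) : Indep (m₁ ⊔ m₃) m₂ P := by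
  set π : Set (Set Ω) := {s | ∃ u v, MeasurableSet[m₁] u ∧ MeasurableSet[m₃] v ∧ s = u ∩ v} with hπ
  have hgen : m₁ ⊔ m₃ = MeasurableSpace.generateFrom π := by
    apply le_antisymm
    · refine sup_le (fun s hs => ?_) (fun s hs => ?_)
      · exact MeasurableSpace.measurableSet_generateFrom
          ⟨s, Set.univ, hs, MeasurableSet.univ, by simp⟩
      · exact MeasurableSpace.measurableSet_generateFrom
          ⟨Set.univ, s, MeasurableSet.univ, hs, by simp⟩
    · refine MeasurableSpace.generateFrom_le ?_
      rintro s ⟨u, v, hu, hv, rfl⟩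
      exact MeasurableSet.inter (le_sup_left (a := m₁) (b := m₃) _ hu)
        (le_sup_right (a := m₁) (b := m₃) _ hv)
  refine IndepSets.indep (sup_le h₁ h₃) h₂ ?_ (@MeasurableSpace.isPiSystem_measurableSet _ m₂) hgen
    (@MeasurableSpace.generateFrom_measurableSet _ m₂).symm ?_
  · rintro s ⟨u, v, hu, hv, rfl⟩ t ⟨u', v', hu', hv', rfl⟩ -
    exact ⟨u ∩ u', v ∩ v', hu.inter hu', hv.inter hv', Set.inter_inter_inter_comm _ _ _ _⟩
  · rw [IndepSets_iff]
    rintro s t ⟨u, v, hu, hv, rfl⟩ ht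
    rw [Indep_iff] at h12 h123
    have hu' : MeasurableSet[m₁ ⊔ m₂] u := le_sup_left (a := m₁) (b := m₂) _ hu
    have ht' : MeasurableSet[m₁ ⊔ m₂] t := le_sup_right (a := m₁) (b := m₂) _ ht
    rw [h123 u v hu' hv, Set.inter_right_comm, h123 (u ∩ t) v (MeasurableSet.inter hu' ht') hv,
      h12 u t hu ht]
    ring

variable {n d : ℕ} {Q : Problem n d} {A : Matrix (Fin n) (Fin n) ℝ} {α β : ℕ → ℝ} {γ : ℕ → ℕ}
  {x₀ : Fin n → Vec d}
  {ξ : (p : Fin n × ℕ × ℕ) → Ω → Q.Sample p.1} {N : Fin n × ℕ → Ω → Vec d}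

/-- The state at time `k` depends on the randomness consumed before time `k` only. -/
theorem measurable_iterate [MeasurableSpace Ω] {k : ℕ} (hξ : ∀ p, p.2.1 < k → Measurable (ξ p))
    (hN : ∀ p, p.2 < k → Measurable (N p)) :
    Measurable (iterate Q A α β γ x₀ ξ N k) := by
  induction k with
  | zero => exact measurable_const
  | succ k ih =>
    have h := ih (fun p hp => hξ p (hp.trans k.lt_succ_self))
      fun p hp => hN p (hp.trans k.lt_succ_self)
    have hi : ∀ i, Measurable fun ω => iterate Q A α β γ x₀ ξ N k ω i := fun i =>
      (measurable_pi_apply i).comp h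
    refine measurable_pi_lambda _ fun i => ?_
    have hg : ∀ l, Measurable fun ω => Q.g i (iterate Q A α β γ x₀ ξ N k ω i) (ξ (i, k, l) ω) :=
      fun l => (Q.measurable_g i).comp ((hi i).prodMk (hξ (i, k, l) k.lt_succ_self))
    have hn := hN (i, k) k.lt_succ_self
    simp only [iterate, avgGrad]
    fun_prop

theorem IsRandomInput.measurable_iterate [MeasurableSpace Ω] {P : Measure Ω} {σ : ℕ → ℝ}
    (hin : IsRandomInput Q σ P ξ N) (k : ℕ) :
    Measurable (iterate Q A α β γ x₀ ξ N k) :=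
  PrivateDSO.measurable_iterate (fun p _ => hin.measurable_sample p) fun p _ => hin.measurable_noise p

/-- `measurable_iterate` is valid for every σ-algebra on Ω, in particular for the one generated by
the past inputs. -/
theorem comap_iterate_le (k : ℕ) :
    MeasurableSpace.comap (iterate Q A α β γ x₀ ξ N k) inferInstance
      ≤ (⨆ p ∈ {p : Fin n × ℕ × ℕ | p.2.1 < k}, MeasurableSpace.comap (ξ p) inferInstance)
        ⊔ ⨆ p ∈ {p : Fin n × ℕ | p.2 < k}, MeasurableSpace.comap (N p) inferInstance := by
  refine Measurable.comap_le (@measurable_iterate _ _ _ _ _ _ _ _ _ _ _ (_ ⊔ _) k ?_ ?_)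
  · intro p hp
    exact measurable_iff_comap_le.2 (le_sup_of_le_left (le_iSup₂_of_le p hp le_rfl))
  · intro p hp
    exact measurable_iff_comap_le.2 (le_sup_of_le_right (le_iSup₂_of_le p hp le_rfl))

theorem iSup_comap_le_comap_pi {ι : Type*} {κ : ι → Type*} [∀ i, MeasurableSpace (κ i)]
    (X : ∀ i, Ω → κ i) (S : Set ι) :
    ⨆ i ∈ S, MeasurableSpace.comap (X i) inferInstance
      ≤ MeasurableSpace.comap (fun ω i => X i ω) MeasurableSpace.pi := by
  refine iSup₂_le fun i _ => ?_
  have : X i = (fun x : ∀ i, κ i => x i) ∘ fun ω i => X i ω := rfl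
  rw [this, ← MeasurableSpace.comap_comp]
  exact MeasurableSpace.comap_mono (measurable_pi_apply i).comap_le

variable [MeasurableSpace Ω] {P : Measure Ω} [IsProbabilityMeasure P] {σ : ℕ → ℝ}

theorem IsRandomInput.indepFun_iterate_sample (hin : IsRandomInput Q σ P ξ N) (i : Fin n) (k l : ℕ) :
    IndepFun (iterate Q A α β γ x₀ ξ N k) (ξ (i, k, l)) P := by
  rw [IndepFun_iff_Indep]
  refine indep_of_indep_of_le_left ?_ (comap_iterate_le k)
  have hξ : ∀ p, MeasurableSpace.comap (ξ p) inferInstance ≤ ‹MeasurableSpace Ω› := fun p =>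
    (hin.measurable_sample p).comap_le
  have hN : ∀ p, MeasurableSpace.comap (N p) inferInstance ≤ ‹MeasurableSpace Ω› := fun p =>
    (hin.measurable_noise p).comap_le
  have hone : MeasurableSpace.comap (ξ (i, k, l)) inferInstance
      = ⨆ p ∈ ({(i, k, l)} : Set (Fin n × ℕ × ℕ)), MeasurableSpace.comap (ξ p) inferInstance := by
    rw [_root_.iSup_singleton]
  refine indep_sup_left_of_indep_sup (iSup₂_le fun p _ => hξ p) (hξ _) (iSup₂_le fun p _ => hN p)
    ?_ ?_
  · rw [hone]
    refine indep_iSup_of_disjoint hξ hin.indep_sample.iIndep ?_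
    rw [Set.disjoint_singleton_right]
    exact lt_irrefl k
  · refine indep_of_indep_of_le ((IndepFun_iff_Indep _ _ _).1 hin.indep_sample_noise)
      (sup_le (iSup_comap_le_comap_pi ξ _) ?_) (iSup_comap_le_comap_pi N _)
    rw [hone]
    exact iSup_comap_le_comap_pi ξ _

theorem IsRandomInput.indepFun_iterate_noise (hin : IsRandomInput Q σ P ξ N) (i : Fin n) (k : ℕ) :
    IndepFun (iterate Q A α β γ x₀ ξ N k) (N (i, k)) P := by
  rw [IndepFun_iff_Indep]
  refine indep_of_indep_of_le_left ?_ (comap_iterate_le k)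
  have hξ : ∀ p, MeasurableSpace.comap (ξ p) inferInstance ≤ ‹MeasurableSpace Ω› := fun p =>
    (hin.measurable_sample p).comap_le
  have hN : ∀ p, MeasurableSpace.comap (N p) inferInstance ≤ ‹MeasurableSpace Ω› := fun p =>
    (hin.measurable_noise p).comap_le
  have hone : MeasurableSpace.comap (N (i, k)) inferInstance
      = ⨆ p ∈ ({(i, k)} : Set (Fin n × ℕ)), MeasurableSpace.comap (N p) inferInstance := by
    rw [_root_.iSup_singleton]
  rw [sup_comm]
  refine indep_sup_left_of_indep_sup (iSup₂_le fun p _ => hN p) (hN _) (iSup₂_le fun p _ => hξ p)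
    ?_ ?_
  · rw [hone]
    refine indep_iSup_of_disjoint hN hin.indep_noise.iIndep ?_
    rw [Set.disjoint_singleton_right]
    exact lt_irrefl k
  · refine (indep_of_indep_of_le ((IndepFun_iff_Indep _ _ _).1 hin.indep_sample_noise)
      (iSup_comap_le_comap_pi ξ _) (sup_le (iSup_comap_le_comap_pi N _) ?_)).symm
    rw [hone]
    exact iSup_comap_le_comap_pi N _

end Independence

/-! ### Second moments under independent perturbations. -/

section SecondMoments

variable {Ω : Type*} [MeasurableSpace Ω] {P : Measure Ω} {d : ℕ}

theorem integrable_inner_of_memLp {X Y : Ω → Vec d} (hX : MemLp X 2 P) (hY : MemLp Y 2 P) :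
    Integrable (fun ω => inner ℝ (X ω) (Y ω)) P := by
  refine Integrable.mono' (((memLp_two_iff_integrable_sq_norm hX.1).1 hX).add
    ((memLp_two_iff_integrable_sq_norm hY.1).1 hY)) (hX.1.inner hY.1)
    (Filter.Eventually.of_forall fun ω => ?_)
  have h := norm_inner_le_norm (𝕜 := ℝ) (X ω) (Y ω)
  simp only [Pi.add_apply]
  nlinarith [sq_nonneg (‖X ω‖ - ‖Y ω‖), sq_nonneg (‖X ω‖), sq_nonneg (‖Y ω‖)]

/-- The second moment of a random variable perturbed by an uncorrelated one. -/
theorem integral_norm_sub_smul_sq_le {Y Z : Ω → Vec d} (hY : MemLp Y 2 P) (hZ : MemLp Z 2 P)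
    (horth : ∫ ω, inner ℝ (Y ω) (Z ω) ∂P = 0) {c : ℝ} (hc : ∫ ω, ‖Z ω‖ ^ 2 ∂P ≤ c) (a : ℝ) :
    ∫ ω, ‖Y ω - a • Z ω‖ ^ 2 ∂P ≤ ∫ ω, ‖Y ω‖ ^ 2 ∂P + a ^ 2 * c := by
  have h : ∀ ω, ‖Y ω - a • Z ω‖ ^ 2
      = ‖Y ω‖ ^ 2 - 2 * a * inner ℝ (Y ω) (Z ω) + a ^ 2 * ‖Z ω‖ ^ 2 := fun ω => by
    rw [norm_sub_sq_real, real_inner_smul_right, norm_smul, mul_pow, Real.norm_eq_abs, sq_abs]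
    ring
  have iY := (memLp_two_iff_integrable_sq_norm hY.1).1 hY
  have iZ := (memLp_two_iff_integrable_sq_norm hZ.1).1 hZ
  have iYZ := integrable_inner_of_memLp hY hZ
  simp_rw [h]
  rw [integral_add (f := fun ω => ‖Y ω‖ ^ 2 - 2 * a * inner ℝ (Y ω) (Z ω))
    (iY.sub (iYZ.const_mul _)) (iZ.const_mul _), integral_sub iY (iYZ.const_mul _),
    integral_const_mul, integral_const_mul, horth]
  nlinarith [mul_le_mul_of_nonneg_left hc (sq_nonneg a)]

variable {𝒮 𝒵 : Type*} [MeasurableSpace 𝒮] [MeasurableSpace 𝒵] [IsProbabilityMeasure P]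
  {S : Ω → 𝒮} {Z : Ω → 𝒵} {h : 𝒮 × 𝒵 → Vec d} {c : ℝ}

/-- The joint law is a product, so Z is integrated out at a frozen state. Working with `lintegral`
makes integrability a conclusion (Tonelli) rather than a prerequisite. -/
theorem memLp_comp_of_indepFun (hS : Measurable S) (hZ : Measurable Z) (hind : IndepFun S Z P)
    (hh : Measurable h) (hmem : ∀ s, MemLp (fun z => h (s, z)) 2 (P.map Z))
    (hc : ∀ s, ∫ z, ‖h (s, z)‖ ^ 2 ∂(P.map Z) ≤ c) :
    MemLp (fun ω => h (S ω, Z ω)) 2 P ∧ ∫ ω, ‖h (S ω, Z ω)‖ ^ 2 ∂P ≤ c := by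
  have : IsProbabilityMeasure (P.map S) := Measure.isProbabilityMeasure_map hS.aemeasurable
  have : IsProbabilityMeasure (P.map Z) := Measure.isProbabilityMeasure_map hZ.aemeasurable
  have hmap : P.map (fun ω => (S ω, Z ω)) = (P.map S).prod (P.map Z) :=
    (indepFun_iff_map_prod_eq_prod_map_map hS.aemeasurable hZ.aemeasurable).1 hind
  have hmeas : Measurable fun p : 𝒮 × 𝒵 => ‖h p‖ ^ 2 := hh.norm.pow_const 2
  have hsq : ∀ s, Integrable (fun z => ‖h (s, z)‖ ^ 2) (P.map Z) := fun s =>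
    (memLp_two_iff_integrable_sq_norm (hmem s).1).1 (hmem s)
  have hlin : ∫⁻ ω, ENNReal.ofReal (‖h (S ω, Z ω)‖ ^ 2) ∂P ≤ ENNReal.ofReal c := by
    have h1 := lintegral_map (μ := P) hmeas.ennreal_ofReal (hS.prodMk hZ)
    rw [← h1, hmap, lintegral_prod _ hmeas.ennreal_ofReal.aemeasurable]
    calc ∫⁻ s, ∫⁻ z, ENNReal.ofReal (‖h (s, z)‖ ^ 2) ∂(P.map Z) ∂(P.map S)
        ≤ ∫⁻ _, ENNReal.ofReal c ∂(P.map S) := lintegral_mono fun s => by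
          rw [← ofReal_integral_eq_lintegral_ofReal (hsq s)
            (Filter.Eventually.of_forall fun z => sq_nonneg _)]
          exact ENNReal.ofReal_le_ofReal (hc s)
      _ = ENNReal.ofReal c := by rw [lintegral_const, measure_univ, mul_one]
  have hmeas' : Measurable fun ω => h (S ω, Z ω) := hh.comp (hS.prodMk hZ)
  have hc0 : 0 ≤ c := by
    obtain ⟨ω⟩ := P.nonempty_of_neZero
    exact (integral_nonneg fun z => sq_nonneg _).trans (hc (S ω))
  constructor
  · rw [memLp_two_iff_integrable_sq_norm hmeas'.aestronglyMeasurable]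
    refine ⟨(hmeas'.norm.pow_const 2).aestronglyMeasurable, ?_⟩
    rw [hasFiniteIntegral_iff_ofReal (Filter.Eventually.of_forall fun ω => sq_nonneg _)]
    exact hlin.trans_lt ENNReal.ofReal_lt_top
  · rw [integral_eq_lintegral_of_nonneg_ae (Filter.Eventually.of_forall fun ω => sq_nonneg _)
      (hmeas'.norm.pow_const 2).aestronglyMeasurable]
    exact ENNReal.toReal_le_of_le_ofReal hc0 hlin

/-- Fresh centred randomness is uncorrelated with every function of the state. -/
theorem integral_inner_comp_eq_zero (hS : Measurable S) (hZ : Measurable Z) (hind : IndepFun S Z P)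
    (hh : Measurable h) (hmem : ∀ s, MemLp (fun z => h (s, z)) 2 (P.map Z))
    (hc : ∀ s, ∫ z, ‖h (s, z)‖ ^ 2 ∂(P.map Z) ≤ c) (hzero : ∀ s, ∫ z, h (s, z) ∂(P.map Z) = 0)
    {φ : 𝒮 → Vec d} (hφ : Measurable φ) (hφ2 : MemLp (fun ω => φ (S ω)) 2 P) :
    ∫ ω, inner ℝ (φ (S ω)) (h (S ω, Z ω)) ∂P = 0 := by
  have : IsProbabilityMeasure (P.map S) := Measure.isProbabilityMeasure_map hS.aemeasurable
  have : IsProbabilityMeasure (P.map Z) := Measure.isProbabilityMeasure_map hZ.aemeasurable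
  have hmap : P.map (fun ω => (S ω, Z ω)) = (P.map S).prod (P.map Z) :=
    (indepFun_iff_map_prod_eq_prod_map_map hS.aemeasurable hZ.aemeasurable).1 hind
  have hmeas : Measurable fun p : 𝒮 × 𝒵 => (inner ℝ (φ p.1) (h p) : ℝ) :=
    (hφ.comp measurable_fst).inner hh
  have hint := integrable_inner_of_memLp hφ2 (memLp_comp_of_indepFun hS hZ hind hh hmem hc).1
  have hint' : Integrable (fun p : 𝒮 × 𝒵 => (inner ℝ (φ p.1) (h p) : ℝ))
      ((P.map S).prod (P.map Z)) := by
    rw [← hmap]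
    exact (integrable_map_measure hmeas.aestronglyMeasurable (hS.prodMk hZ).aemeasurable).2 hint
  have h1 := integral_map (hS.prodMk hZ).aemeasurable (μ := P) hmeas.aestronglyMeasurable
  rw [← h1, hmap, integral_prod _ hint']
  simp only
  refine integral_eq_zero_of_ae (Filter.Eventually.of_forall fun s => ?_)
  change ∫ z, inner ℝ (φ s) (h (s, z)) ∂(P.map Z) = 0
  rw [integral_inner ((hmem s).integrable one_le_two), hzero, inner_zero_right]

end SecondMoments

/-! ### Regularity of gradients and the optimality condition. -/

section Gradients

variable {n d : ℕ} {Q : Problem n d} {L : Fin n → ℝ} {μ : ℝ}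

theorem Problem.SmoothStronglyConvex.measurable_gradient (hf : Q.SmoothStronglyConvex L μ)
    (i : Fin n) : Measurable (gradient (Q.f i)) := by
  have : LipschitzWith (Real.toNNReal (L i)) (gradient (Q.f i)) :=
    LipschitzWith.of_dist_le_mul fun x y => by
      rw [dist_eq_norm, dist_eq_norm, Real.coe_toNNReal _ (hf.L_pos i).le]
      exact hf.lipschitz i x y
  exact this.continuous.measurable

theorem Problem.SmoothStronglyConvex.sum_gradient_eq_zero (hf : Q.SmoothStronglyConvex L μ)
    {xs : Vec d} (hxs : Q.IsOptimal xs) : ∑ i, gradient (Q.f i) xs = 0 := by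
  have h1 : HasFDerivAt (fun x => ∑ i, Q.f i x)
      (∑ i, InnerProductSpace.toDual ℝ (Vec d) (gradient (Q.f i) xs)) xs :=
    HasFDerivAt.fun_sum fun i _ => (hf.differentiable i xs).hasGradientAt.hasFDerivAt
  have h2 : IsLocalMin (fun x => ∑ i, Q.f i x) xs := Filter.Eventually.of_forall hxs
  have h3 := h2.hasFDerivAt_eq_zero h1
  rw [← map_sum] at h3
  exact (LinearIsometryEquiv.map_eq_zero_iff _).1 h3

end Gradients

/-! ### The stochastic step and the recursion for the mean-square error. -/

section Step

variable {n d : ℕ} {Q : Problem n d} {A : Matrix (Fin n) (Fin n) ℝ} {α β σ : ℕ → ℝ} {γ : ℕ → ℕ}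
  {x₀ : Fin n → Vec d} {Ω : Type*}
  {ξ : (p : Fin n × ℕ × ℕ) → Ω → Q.Sample p.1} {N : Fin n × ℕ → Ω → Vec d}
  {L : Fin n → ℝ} {μ σg : ℝ}

/-- One step of the algorithm from the states `x` without stochastic errors, relative to `xs`. -/
def meanStep (Q : Problem n d) (A : Matrix (Fin n) (Fin n) ℝ) (a b : ℝ) (xs : Vec d) (i : Fin n)
    (x : Fin n → Vec d) : Vec d :=
  (1 - b) • (x i - xs) + b • (∑ j, A i j • (x j - xs)) - a • gradient (Q.f i) (x i)

theorem Problem.SmoothStronglyConvex.measurable_meanStep (hf : Q.SmoothStronglyConvex L μ)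
    (a b : ℝ) (xs : Vec d) (i : Fin n) : Measurable (meanStep Q A a b xs i) := by
  have := (hf.measurable_gradient i).comp (measurable_pi_apply (X := fun _ : Fin n => Vec d) i)
  simp only [Function.comp_def] at this
  unfold meanStep
  fun_prop

/-- The stochastic error of one step: the sampling error of the averaged gradient plus the noise. -/
def stepNoise (Q : Problem n d) (A : Matrix (Fin n) (Fin n) ℝ) (α β : ℕ → ℝ) (γ : ℕ → ℕ)
    (x₀ : Fin n → Vec d) (ξ : (p : Fin n × ℕ × ℕ) → Ω → Q.Sample p.1) (N : Fin n × ℕ → Ω → Vec d)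
    (i : Fin n) (k : ℕ) (ω : Ω) : Vec d :=
  (γ k : ℝ)⁻¹ • (∑ l ∈ range (γ k), (Q.g i (iterate Q A α β γ x₀ ξ N k ω i) (ξ (i, k, l) ω)
      - gradient (Q.f i) (iterate Q A α β γ x₀ ξ N k ω i))) + N (i, k) ω

theorem iterate_succ_sub (hrow : ∀ i, ∑ j, A i j = 1) (hγ : ∀ k, 0 < γ k) (xs : Vec d) (k : ℕ)
    (ω : Ω) (i : Fin n) :
    iterate Q A α β γ x₀ ξ N (k + 1) ω i - xs
      = meanStep Q A (α k) (β k) xs i (iterate Q A α β γ x₀ ξ N k ω)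
        - α k • stepNoise Q A α β γ x₀ ξ N i k ω := by
  have hγ' : (γ k : ℝ) ≠ 0 := by exact_mod_cast (hγ k).ne'
  simp only [iterate, avgGrad, stepNoise, meanStep, smul_sub, sum_sub_distrib, ← sum_smul,
    hrow, sum_const, card_range, smul_add]
  rw [← Nat.cast_smul_eq_nsmul ℝ, inv_smul_smul₀ hγ']
  module

variable [MeasurableSpace Ω] {P : Measure Ω}

theorem IsRandomInput.memLp_noise (hin : IsRandomInput Q σ P ξ N) {p : Fin n × ℕ}
    (hσ : 0 < σ p.2) (c : Fin d) : MemLp (fun ω => N p ω c) 2 P := by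
  have hm : Measurable fun ω => N p ω c := (by fun_prop : Measurable fun x : Vec d => x c).comp
    (hin.measurable_noise p)
  have h := memLp_id_laplaceMeasure hσ
  rw [← hin.law_noise p c] at h
  exact (memLp_map_measure_iff h.1 hm.aemeasurable).1 h

variable [IsProbabilityMeasure P]

/-- The privacy noise is centred, with second moment `2 d σ ^ 2`. -/
theorem IsRandomInput.noise_moments (hin : IsRandomInput Q σ P ξ N) {p : Fin n × ℕ}
    (hσ : 0 < σ p.2) :
    MemLp (fun z => z) 2 (P.map (N p)) ∧ ∫ z, ‖z‖ ^ 2 ∂(P.map (N p)) = 2 * d * σ p.2 ^ 2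
      ∧ ∫ z, z ∂(P.map (N p)) = 0 := by
  have hN := hin.measurable_noise p
  have hm : ∀ c, Measurable fun ω => N p ω c := fun c =>
    (by fun_prop : Measurable fun x : Vec d => x c).comp hN
  have hint : ∀ c, Integrable (fun ω => N p ω c ^ 2) P := fun c =>
    (hin.memLp_noise hσ c).integrable_sq
  have hL2 : MemLp (N p) 2 P := by
    rw [memLp_two_iff_integrable_sq_norm hN.aestronglyMeasurable]
    simp_rw [EuclideanSpace.real_norm_sq_eq]
    exact integrable_finsetSum _ fun c _ => hint c
  have hL2' : MemLp (fun z => z) 2 (P.map (N p)) :=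
    (memLp_map_measure_iff aestronglyMeasurable_id hN.aemeasurable).2 hL2
  refine ⟨hL2', ?_, ?_⟩
  · rw [integral_map hN.aemeasurable (by fun_prop)]
    simp_rw [EuclideanSpace.real_norm_sq_eq]
    rw [integral_finsetSum _ fun c _ => hint c]
    have : ∀ c, ∫ ω, N p ω c ^ 2 ∂P = 2 * σ p.2 ^ 2 := fun c => by
      rw [← integral_sq_laplaceMeasure hσ, ← hin.law_noise p c,
        integral_map (hm c).aemeasurable (by fun_prop)]
    simp_rw [this]
    rw [sum_const, card_univ, Fintype.card_fin, nsmul_eq_mul]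
    ring
  · rw [integral_map (f := fun z : Vec d => z) hN.aemeasurable aestronglyMeasurable_id]
    ext c
    have h1 := (EuclideanSpace.proj c : Vec d →L[ℝ] ℝ).integral_comp_comm
      (hL2.integrable one_le_two)
    have h2 : ∫ ω, N p ω c ∂P = 0 := by
      rw [← integral_id_laplaceMeasure hσ, ← hin.law_noise p c,
        integral_map (hm c).aemeasurable (by fun_prop)]
    exact h1.symm.trans h2

/-- Cauchy–Schwarz. It forgoes the variance reduction 1/γ of independent samples, which the rate
does not need. -/
theorem norm_inv_smul_sum_sq_le {m : ℕ} (w : ℕ → Vec d) :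
    ‖(m : ℝ)⁻¹ • ∑ l ∈ range m, w l‖ ^ 2 ≤ (m : ℝ)⁻¹ * ∑ l ∈ range m, ‖w l‖ ^ 2 := by
  rcases Nat.eq_zero_or_pos m with rfl | hm
  · simp
  have h1 : ‖∑ l ∈ range m, w l‖ ^ 2 ≤ (∑ l ∈ range m, ‖w l‖) ^ 2 := by
    gcongr; exact norm_sum_le _ _
  have h2 : (∑ l ∈ range m, ‖w l‖) ^ 2 ≤ m * ∑ l ∈ range m, ‖w l‖ ^ 2 := by
    simpa using sq_sum_le_card_mul_sum_sq (s := range m) (f := fun l => ‖w l‖)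
  have hm' : (0 : ℝ) < m := by exact_mod_cast hm
  rw [norm_smul, mul_pow, Real.norm_of_nonneg (by positivity)]
  calc (m : ℝ)⁻¹ ^ 2 * ‖∑ l ∈ range m, w l‖ ^ 2
      ≤ (m : ℝ)⁻¹ ^ 2 * (m * ∑ l ∈ range m, ‖w l‖ ^ 2) := by gcongr; exact h1.trans h2
    _ = _ := by field_simp

/-- The error of a single sampled gradient has bounded variance and is uncorrelated with every function
of the current state. -/
theorem sampling_error (hf : Q.SmoothStronglyConvex L μ) (hg : Q.UnbiasedBoundedVariance σg)
    (hin : IsRandomInput Q σ P ξ N) (i : Fin n) (k l : ℕ) :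
    let e := fun ω => Q.g i (iterate Q A α β γ x₀ ξ N k ω i) (ξ (i, k, l) ω)
      - gradient (Q.f i) (iterate Q A α β γ x₀ ξ N k ω i)
    MemLp e 2 P ∧ ∫ ω, ‖e ω‖ ^ 2 ∂P ≤ σg ^ 2 ∧
      ∀ φ : (Fin n → Vec d) → Vec d, Measurable φ →
        MemLp (fun ω => φ (iterate Q A α β γ x₀ ξ N k ω)) 2 P →
        ∫ ω, inner ℝ (φ (iterate Q A α β γ x₀ ξ N k ω)) (e ω) ∂P = 0 := by
  intro e
  have hlaw : P.map (ξ (i, k, l)) = Q.D i := hin.law_sample (i, k, l)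
  set h : (Fin n → Vec d) × Q.Sample i → Vec d := fun p =>
    Q.g i (p.1 i) p.2 - gradient (Q.f i) (p.1 i) with hh
  have hmeas : Measurable h := by
    have h1 : Measurable fun p : (Fin n → Vec d) × Q.Sample i => p.1 i :=
      (measurable_pi_apply i).comp measurable_fst
    exact ((Q.measurable_g i).comp (h1.prodMk measurable_snd)).sub
      ((hf.measurable_gradient i).comp h1)
  have hS : Measurable (iterate Q A α β γ x₀ ξ N k) := hin.measurable_iterate k
  have hZ := hin.measurable_sample (i, k, l)
  have hind : IndepFun (iterate Q A α β γ x₀ ξ N k) (ξ (i, k, l)) P :=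
    hin.indepFun_iterate_sample i k l
  have hmem : ∀ s, MemLp (fun z => h (s, z)) 2 (P.map (ξ (i, k, l))) := fun s => by
    rw [hlaw]
    exact (hg.memLp i (s i)).sub (memLp_const (gradient (Q.f i) (s i)))
  have hc : ∀ s, ∫ z, ‖h (s, z)‖ ^ 2 ∂(P.map (ξ (i, k, l))) ≤ σg ^ 2 := fun s => by
    rw [hlaw]
    exact hg.variance i (s i)
  have hzero : ∀ s, ∫ z, h (s, z) ∂(P.map (ξ (i, k, l))) = 0 := fun s => by
    rw [hlaw]
    simp only [hh]
    rw [integral_sub ((hg.memLp i (s i)).integrable one_le_two) (integrable_const _),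
      hg.unbiased, integral_const, probReal_univ, one_smul, sub_self]
  have h1 := memLp_comp_of_indepFun hS hZ hind hmeas hmem hc
  exact ⟨h1.1, h1.2, fun φ hφ hφ2 =>
    integral_inner_comp_eq_zero hS hZ hind hmeas hmem hc hzero hφ hφ2⟩

/-- The factors 2 come from ‖a + b‖² ≤ 2‖a‖² + 2‖b‖², which avoids any correlation between sampling
error and privacy noise. -/
theorem stepNoise_moments (hf : Q.SmoothStronglyConvex L μ) (hg : Q.UnbiasedBoundedVariance σg)
    (hin : IsRandomInput Q σ P ξ N) (i : Fin n) (k : ℕ) (hσ : 0 < σ k) (hγ : 0 < γ k) :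
    MemLp (stepNoise Q A α β γ x₀ ξ N i k) 2 P ∧
      ∫ ω, ‖stepNoise Q A α β γ x₀ ξ N i k ω‖ ^ 2 ∂P ≤ 2 * σg ^ 2 + 4 * d * σ k ^ 2 ∧
      ∀ φ : (Fin n → Vec d) → Vec d, Measurable φ →
        MemLp (fun ω => φ (iterate Q A α β γ x₀ ξ N k ω)) 2 P →
        ∫ ω, inner ℝ (φ (iterate Q A α β γ x₀ ξ N k ω))
          (stepNoise Q A α β γ x₀ ξ N i k ω) ∂P = 0 := by
  have hsamp := fun l => sampling_error (A := A) (α := α) (β := β) (γ := γ) (x₀ := x₀) hf hg hin i k l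
  set X := iterate Q A α β γ x₀ ξ N k with hX
  set e : ℕ → Ω → Vec d := fun l ω => Q.g i (X ω i) (ξ (i, k, l) ω) - gradient (Q.f i) (X ω i) with he
  obtain ⟨n1, n2, n3⟩ := hin.noise_moments (p := (i, k)) hσ
  have hNmeas := hin.measurable_noise (i, k)
  have hN2 : MemLp (N (i, k)) 2 P :=
    (memLp_map_measure_iff aestronglyMeasurable_id hNmeas.aemeasurable).1 n1
  have hNsq : ∫ ω, ‖N (i, k) ω‖ ^ 2 ∂P = 2 * d * σ k ^ 2 := by
    rw [← n2, integral_map hNmeas.aemeasurable (by fun_prop)]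
  have hNorth : ∀ φ : (Fin n → Vec d) → Vec d, Measurable φ → MemLp (fun ω => φ (X ω)) 2 P →
      ∫ ω, inner ℝ (φ (X ω)) (N (i, k) ω) ∂P = 0 := fun φ hφ hφ2 =>
    integral_inner_comp_eq_zero (h := fun p : (Fin n → Vec d) × Vec d => p.2)
      (hin.measurable_iterate k) hNmeas (hin.indepFun_iterate_noise i k) measurable_snd
      (fun _ => n1) (fun _ => n2.le) (fun _ => n3) hφ hφ2
  set w : Ω → Vec d := fun ω => (γ k : ℝ)⁻¹ • ∑ l ∈ range (γ k), e l ω with hw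
  have hw2 : MemLp w 2 P :=
    (memLp_finsetSum (range (γ k)) fun l _ => (hsamp l).1).const_smul (γ k : ℝ)⁻¹
  have hγ' : (0 : ℝ) < γ k := by exact_mod_cast hγ
  have hsq : ∀ {f : Ω → Vec d}, MemLp f 2 P → Integrable (fun ω => ‖f ω‖ ^ 2) P := fun hf =>
    (memLp_two_iff_integrable_sq_norm hf.1).1 hf
  have hwsq : ∫ ω, ‖w ω‖ ^ 2 ∂P ≤ σg ^ 2 := by
    have hisum : Integrable (fun ω => ∑ l ∈ range (γ k), ‖e l ω‖ ^ 2) P :=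
      integrable_finsetSum _ fun l _ => hsq (hsamp l).1
    calc ∫ ω, ‖w ω‖ ^ 2 ∂P ≤ ∫ ω, (γ k : ℝ)⁻¹ * ∑ l ∈ range (γ k), ‖e l ω‖ ^ 2 ∂P :=
          integral_mono (hsq hw2) (hisum.const_mul _) fun ω => norm_inv_smul_sum_sq_le _
      _ = (γ k : ℝ)⁻¹ * ∑ l ∈ range (γ k), ∫ ω, ‖e l ω‖ ^ 2 ∂P := by
          rw [integral_const_mul, integral_finsetSum _ fun l _ => hsq (hsamp l).1]
      _ ≤ (γ k : ℝ)⁻¹ * ∑ l ∈ range (γ k), σg ^ 2 := by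
          gcongr with l; exact (hsamp l).2.1
      _ = σg ^ 2 := by rw [sum_const, card_range, nsmul_eq_mul]; field_simp
  refine ⟨hw2.add hN2, ?_, fun φ hφ hφ2 => ?_⟩
  · calc ∫ ω, ‖w ω + N (i, k) ω‖ ^ 2 ∂P ≤ ∫ ω, (2 * ‖w ω‖ ^ 2 + 2 * ‖N (i, k) ω‖ ^ 2) ∂P := by
          refine integral_mono (hsq (hw2.add hN2)) (((hsq hw2).const_mul _).add
            ((hsq hN2).const_mul _)) fun ω => ?_
          have h1 : ‖w ω + N (i, k) ω‖ ^ 2 ≤ (‖w ω‖ + ‖N (i, k) ω‖) ^ 2 := by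
            gcongr; exact norm_add_le _ _
          simp only
          nlinarith [sq_nonneg (‖w ω‖ - ‖N (i, k) ω‖)]
      _ = 2 * ∫ ω, ‖w ω‖ ^ 2 ∂P + 2 * ∫ ω, ‖N (i, k) ω‖ ^ 2 ∂P := by
          rw [integral_add ((hsq hw2).const_mul _) ((hsq hN2).const_mul _), integral_const_mul,
            integral_const_mul]
      _ ≤ _ := by rw [hNsq]; linarith
  · have h1 : ∀ ω, inner ℝ (φ (X ω)) (stepNoise Q A α β γ x₀ ξ N i k ω)
        = (γ k : ℝ)⁻¹ * ∑ l ∈ range (γ k), inner ℝ (φ (X ω)) (e l ω)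
          + inner ℝ (φ (X ω)) (N (i, k) ω) := fun ω => by
      rw [stepNoise, inner_add_right, real_inner_smul_right, inner_sum]
    have hi : ∀ l ∈ range (γ k), Integrable (fun ω => inner ℝ (φ (X ω)) (e l ω)) P := fun l _ =>
      integrable_inner_of_memLp hφ2 (hsamp l).1
    simp_rw [h1]
    rw [integral_add ((integrable_finsetSum _ hi).const_mul _) (integrable_inner_of_memLp hφ2 hN2),
      integral_const_mul, integral_finsetSum _ hi, hNorth φ hφ hφ2,
      sum_eq_zero fun l _ => (hsamp l).2.2 φ hφ hφ2]
    simp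

theorem Problem.SmoothStronglyConvex.memLp_meanStep (hf : Q.SmoothStronglyConvex L μ)
    {xs : Vec d} {X : Ω → Fin n → Vec d} (hXm : Measurable X)
    (hX : ∀ i, MemLp (fun ω => X ω i - xs) 2 P) (a b : ℝ) (i : Fin n) :
    MemLp (fun ω => meanStep Q A a b xs i (X ω)) 2 P := by
  have h1 : MemLp (fun ω => gradient (Q.f i) (X ω i) - gradient (Q.f i) xs) 2 P :=
    (hX i).of_le_mul (c := L i) (((hf.measurable_gradient i).comp
      ((measurable_pi_apply i).comp hXm)).sub_const _).aestronglyMeasurable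
      (Filter.Eventually.of_forall fun ω => hf.lipschitz i _ _)
  have h2 : MemLp (fun ω => gradient (Q.f i) (X ω i)) 2 P := by
    have h3 := h1.add (memLp_const (gradient (Q.f i) xs))
    refine h3.ae_eq (Filter.Eventually.of_forall fun ω => ?_)
    simp
  have h3 : MemLp (fun ω => ∑ j, A i j • (X ω j - xs)) 2 P :=
    memLp_finsetSum univ fun j _ => (hX j).const_smul (A i j)
  exact (((hX i).const_smul (1 - b)).add (h3.const_smul b)).sub (h2.const_smul a)

theorem memLp_iterate_sub (hf : Q.SmoothStronglyConvex L μ) (hg : Q.UnbiasedBoundedVariance σg)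
    (hrow : ∀ i, ∑ j, A i j = 1) (hin : IsRandomInput Q σ P ξ N) (hσ : ∀ k, 0 < σ k)
    (hγ : ∀ k, 0 < γ k) (xs : Vec d) (k : ℕ) (i : Fin n) :
    MemLp (fun ω => iterate Q A α β γ x₀ ξ N k ω i - xs) 2 P := by
  induction k generalizing i with
  | zero => exact memLp_const (x₀ i - xs)
  | succ k ih =>
    simp_rw [iterate_succ_sub hrow hγ xs]
    exact (hf.memLp_meanStep (hin.measurable_iterate k) ih _ _ i).sub
      ((stepNoise_moments hf hg hin i k (hσ k) (hγ k)).1.const_smul (α k))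

/-- The mean-square error of the agents satisfies a scalar recursion. -/
theorem exists_error_recursion (hf : Q.SmoothStronglyConvex L μ) (hg : Q.UnbiasedBoundedVariance σg)
    {G : SimpleGraph (Fin n)} (hA : IsWeightMatrix G A) (hin : IsRandomInput Q σ P ξ N)
    {xs : Vec d} (hxs : Q.IsOptimal xs) (hα : ∀ k, 0 < α k) (hβ : ∀ k, 0 < β k) (hβ1 : ∀ k, β k ≤ 1)
    (hσ : ∀ k, 0 < σ k) (hγ : ∀ k, 0 < γ k) :
    ∃ C : ℝ, 0 < C ∧ ∀ k,
      ∑ i, ∫ ω, ‖iterate Q A α β γ x₀ ξ N (k + 1) ω i - xs‖ ^ 2 ∂P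
        ≤ (1 - 2 * μ * α k + C * (α k * β k + α k ^ 2))
            * ∑ i, ∫ ω, ‖iterate Q A α β γ x₀ ξ N k ω i - xs‖ ^ 2 ∂P
          + C * (α k ^ 2 / β k + α k ^ 2 * (1 + σ k ^ 2)) := by
  have hsq : ∀ {f : Ω → Vec d}, MemLp f 2 P → Integrable (fun ω => ‖f ω‖ ^ 2) P := fun hf =>
    (memLp_two_iff_integrable_sq_norm hf.1).1 hf
  set Lm := ∑ i, L i with hLm
  have hLi : ∀ i, L i ≤ Lm := fun i =>
    single_le_sum (fun j _ => (hf.L_pos j).le) (mem_univ i)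
  obtain ⟨C, hC, hdrift⟩ := hA.exists_drift_le Lm μ (sum_nonneg fun i _ => (hf.L_pos i).le)
    (fun i => gradient (Q.f i) xs) (hf.sum_gradient_eq_zero hxs)
  -- Chosen so that n(2σg² + 4dσ_k²) ≤ R(1 + σ_k²) for all k.
  set R : ℝ := n * (2 * σg ^ 2 + 4 * d) with hR
  have hR0 : 0 ≤ R := by positivity
  refine ⟨C + R, by positivity, fun k => ?_⟩
  have hmem := memLp_iterate_sub (α := α) (β := β) (x₀ := x₀) hf hg hA.row_sum hin hσ hγ xs k
  have hmean2 := fun i => hf.memLp_meanStep (A := A) (hin.measurable_iterate k) hmem (α k) (β k) i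
  have hnoise := fun i => stepNoise_moments (A := A) (α := α) (β := β) (γ := γ) (x₀ := x₀)
    hf hg hin i k (hσ k) (hγ k)
  have hsucc := iterate_succ_sub (α := α) (β := β) (x₀ := x₀) (ξ := ξ) (N := N) hA.row_sum hγ xs k
  generalize iterate Q A α β γ x₀ ξ N (k + 1) = X' at hsucc ⊢
  generalize iterate Q A α β γ x₀ ξ N k = X at hmem hmean2 hnoise hsucc ⊢
  set V := ∑ i, ∫ ω, ‖X ω i - xs‖ ^ 2 ∂P with hV
  have hV0 : 0 ≤ V := sum_nonneg fun i _ => integral_nonneg fun ω => sq_nonneg _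
  have hnoisy : ∑ i, ∫ ω, ‖X' ω i - xs‖ ^ 2 ∂P
      ≤ ∑ i, ∫ ω, ‖meanStep Q A (α k) (β k) xs i (X ω)‖ ^ 2 ∂P
        + α k ^ 2 * (n * (2 * σg ^ 2 + 4 * d * σ k ^ 2)) := by
    calc ∑ i, ∫ ω, ‖X' ω i - xs‖ ^ 2 ∂P
        ≤ ∑ i, (∫ ω, ‖meanStep Q A (α k) (β k) xs i (X ω)‖ ^ 2 ∂P
            + α k ^ 2 * (2 * σg ^ 2 + 4 * d * σ k ^ 2)) := by
          refine sum_le_sum fun i _ => ?_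
          simp_rw [hsucc]
          exact integral_norm_sub_smul_sq_le (hmean2 i) (hnoise i).1
            ((hnoise i).2.2 _ (hf.measurable_meanStep _ _ xs i) (hmean2 i)) (hnoise i).2.1 _
      _ = _ := by
          rw [sum_add_distrib, sum_const, card_univ, Fintype.card_fin, nsmul_eq_mul]; ring
  have hmean : ∑ i, ∫ ω, ‖meanStep Q A (α k) (β k) xs i (X ω)‖ ^ 2 ∂P
      ≤ (1 - 2 * μ * α k + C * (α k * β k + α k ^ 2)) * V + C * (α k ^ 2 / β k + α k ^ 2) := by
    rw [← integral_finsetSum _ fun i _ => hsq (hmean2 i)]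
    have hiV : Integrable (fun ω => ∑ i, ‖X ω i - xs‖ ^ 2) P :=
      integrable_finsetSum _ fun i _ => hsq (hmem i)
    calc ∫ ω, ∑ i, ‖meanStep Q A (α k) (β k) xs i (X ω)‖ ^ 2 ∂P
        ≤ ∫ ω, ((1 - 2 * μ * α k + C * (α k * β k + α k ^ 2)) * ∑ i, ‖X ω i - xs‖ ^ 2
            + C * (α k ^ 2 / β k + α k ^ 2)) ∂P := by
          refine integral_mono (integrable_finsetSum _ fun i _ => hsq (hmean2 i))
            ((hiV.const_mul _).add (integrable_const _)) fun ω => ?_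
          exact hdrift (α k) (β k) (fun i => X ω i - xs) (fun i => gradient (Q.f i) (X ω i))
            (hα k) (hβ k) (hβ1 k)
            (fun i => (hf.lipschitz i _ _).trans
              (mul_le_mul_of_nonneg_right (hLi i) (norm_nonneg _)))
            (fun i => hf.strong i _ _)
      _ = _ := by
          rw [integral_add (hiV.const_mul _) (integrable_const _), integral_const_mul,
            integral_finsetSum _ fun i _ => hsq (hmem i), integral_const, probReal_univ, one_smul]
  have hαβ := mul_pos (hα k) (hβ k)
  have p1 : 0 ≤ R * ((α k * β k + α k ^ 2) * V) := by positivity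
  have p2 : 0 ≤ R * (α k ^ 2 / β k) := by
    have := hβ k
    positivity
  have p3 : α k ^ 2 * (n * (2 * σg ^ 2 + 4 * d * σ k ^ 2)) ≤ R * (α k ^ 2 * (1 + σ k ^ 2)) := by
    have : R * (α k ^ 2 * (1 + σ k ^ 2)) - α k ^ 2 * (n * (2 * σg ^ 2 + 4 * d * σ k ^ 2))
        = α k ^ 2 * (n * (2 * σg ^ 2 * σ k ^ 2 + 4 * d)) := by rw [hR]; ring
    have h2 : 0 ≤ α k ^ 2 * (n * (2 * σg ^ 2 * σ k ^ 2 + 4 * d)) := by positivity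
    linarith
  have p4 : 0 ≤ C * (α k ^ 2 * σ k ^ 2) := by positivity
  linarith

end Step

end PrivateDSO

end

/-! ### Oracle complexity. -/

theorem corollary3
    {n d : ℕ} (Q : PrivateDSO.Problem n d)
    (L : Fin n → ℝ) (μ σg : ℝ)
    (hf : Q.SmoothStronglyConvex L μ) (hg : Q.UnbiasedBoundedVariance σg)
    (G : SimpleGraph (Fin n)) (A : Matrix (Fin n) (Fin n) ℝ)
    (hA : PrivateDSO.IsWeightMatrix G A)
    (a₁ a₃ b ε : ℝ) (ha₁ : 0 < a₁) (ha₁' : a₁ < 1) (ha₃ : 0 < a₃) (hb : 0 < b)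
    (hε : 0 < ε) (hε' : ε < 1 / 8)
    (α β σ : ℕ → ℝ) (γ : ℕ → ℕ)
    (hα : ∀ k : ℕ, α k = a₁ / ((k : ℝ) + 1) ^ (1 - ε))
    (hβ : ∀ k : ℕ, β k = a₁ / ((k : ℝ) + 1) ^ (0.5 + ε))
    (hγ : ∀ k : ℕ, γ k = ⌈a₃ * ((k : ℝ) + 1) ^ ε⌉₊)
    (hσ : ∀ k : ℕ, σ k = b * ((k : ℝ) + 1) ^ ε)
    (x₀ : Fin n → PrivateDSO.Vec d) (xs : PrivateDSO.Vec d) (hxs : Q.IsOptimal xs)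
    {Ω : Type*} [MeasurableSpace Ω] (P : Measure Ω) [IsProbabilityMeasure P]
    (ξ : (p : Fin n × ℕ × ℕ) → Ω → Q.Sample p.1) (N : Fin n × ℕ → Ω → PrivateDSO.Vec d)
    (hin : PrivateDSO.IsRandomInput Q σ P ξ N) :
    ∃ M : ℝ, 0 < M ∧ ∀ τ : ℝ, 0 < τ → τ ≤ 1 →
      ∃ K : ℕ,
        IsLeast {k : ℕ | PrivateDSO.IsAccurateAt Q A α β γ x₀ ξ N P xs τ k} K ∧
        (∑ k ∈ range (K + 1), (γ k : ℝ)) ≤ M * τ ^ (-((1 + ε) / (0.5 - 4 * ε))) := by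
  have hpos : ∀ (k : ℕ) (s : ℝ), 0 < ((k : ℝ) + 1) ^ s := fun k s => by positivity
  have hαpos : ∀ k, 0 < α k := fun k => by rw [hα]; exact div_pos ha₁ (hpos k _)
  have hβpos : ∀ k, 0 < β k := fun k => by rw [hβ]; exact div_pos ha₁ (hpos k _)
  have hβ1 : ∀ k, β k ≤ 1 := fun k => by
    rw [hβ, div_le_one (hpos k _)]
    refine ha₁'.le.trans (Real.one_le_rpow ?_ (by positivity))
    linarith [Nat.cast_nonneg (α := ℝ) k]
  have hσpos : ∀ k, 0 < σ k := fun k => by rw [hσ]; exact mul_pos hb (hpos k _)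
  have hγpos : ∀ k, 0 < γ k := fun k => by
    rw [hγ]; exact Nat.ceil_pos.2 (mul_pos ha₃ (hpos k _))
  obtain ⟨C, hC, hrec⟩ := PrivateDSO.exists_error_recursion (x₀ := x₀) hf hg hA hin hxs hαpos
    hβpos hβ1 hσpos hγpos
  have hmem := PrivateDSO.memLp_iterate_sub (α := α) (β := β) (x₀ := x₀) hf hg hA.row_sum hin hσpos
    hγpos xs
  obtain ⟨B, hB, hrate⟩ := PrivateDSO.exists_le_rpow_of_recursion
    (V := fun k => ∑ i, ∫ ω, ‖PrivateDSO.iterate Q A α β γ x₀ ξ N k ω i - xs‖ ^ 2 ∂P)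
    ha₁ ha₁' hε hε' hf.μ_pos hC.le hα hβ hσ
    (fun k => sum_nonneg fun i _ => integral_nonneg fun ω => sq_nonneg _) hrec
  obtain ⟨M, hM, hcount⟩ := PrivateDSO.exists_sum_le_rpow (p := 0.5 - 4 * ε) ha₃ hε
    (by linarith) hB hγ
  refine ⟨M, hM, fun τ hτ hτ1 => ?_⟩
  obtain ⟨k₀, hk₀, hsum⟩ := hcount τ hτ hτ1
  -- Each agent's error is at most the total; the first accurate time is then at most `k₀`, and
  -- `hsum` covers every such time.
  have hacc : k₀ ∈ {k : ℕ | PrivateDSO.IsAccurateAt Q A α β γ x₀ ξ N P xs τ k} := fun i =>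
    ⟨(memLp_two_iff_integrable_sq_norm (hmem k₀ i).1).1 (hmem k₀ i),
      (single_le_sum (f := fun i => ∫ ω, ‖PrivateDSO.iterate Q A α β γ x₀ ξ N k₀ ω i - xs‖ ^ 2 ∂P)
        (fun i _ => integral_nonneg fun ω => sq_nonneg _) (mem_univ i)).trans
        ((hrate k₀).trans hk₀)⟩
  exact ⟨sInf {k : ℕ | PrivateDSO.IsAccurateAt Q A α β γ x₀ ξ N P xs τ k},
    ⟨Nat.sInf_mem ⟨k₀, hacc⟩, fun k hk => Nat.sInf_le hk⟩, hsum _ (Nat.sInf_le hacc)⟩
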